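/- Let $|\psi\rangle\in\mathbb C^{d_A}\otimes\mathbb C^{d_B}$ be a unit vector with Schmidt decomposition $|\psi\rangle=\sum_{i=1}^{d}C_i|i\rangle_A|i\rangle_B$, where $d=\min(d_A,d_B)$, $C_i\ge 0$ (some $C_i$ may vanish; $0\log 0:=0$), and $\{|i\rangle_A\}$, $\{|i\rangle_B\}$ are orthonormal bases of the two factors. Let $E$ be the relative entropy of entanglement, $E(\rho)=\inf_\sigma \operatorname{tr}\rho(\log\rho-\log\sigma)$, the infimum being over the separable states $\sigma$ whose support contains that of $\rho$. For a Hermitian matrix $H$ put $$\Gamma(\psi,H)=\frac{d}{dt}E\big(e^{-iHt}|\psi\rangle\langle\psi|e^{iHt}\big)\Big|_{t=0},\qquad \Delta E^2(\psi,H)=\langle\psi|H^2|\psi\rangle-\langle\psi|H|\psi\rangle^2 .$$ Let $H_I$ be the entrywise imaginary part of the matrix of $H$ in the basis $|k\rangle_A|m\rangle_B$, and let $k_i=\langle ii|H_I|\psi\rangle$. Then the following hold. 1. For every Hermitian $H$ the derivative defining $\Gamma(\psi,H)$ exists. 2. Let $H$ maximise $\Gamma(\psi,\cdot)$ over all Hermitian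 matrices subject to the constraint $\Delta E^2(\psi,H)=1$ (or, instead, subject to $\Delta E^2(\psi,H)\le 1$, or subject to $\langle\psi|H_IH_I^T|\psi\rangle=1$). Then $\sum_i C_ik_i=0$, and there are real numbers $\lambda_1,\lambda_2$ with $$C_i\log C_i-2\lambda_1k_i-\lambda_2C_i=0\qquad\text{for all } i .$$ If $H_I|\psi\rangle=\sum_i k_i|ii\rangle$ and $\langle\psi|H_IH_I^T|\psi\rangle=1$, then also $\sum_i k_i^2=1$. These two conditions, and hence $\sum_i k_i^2=1$, hold automatically whenever the nonzero Schmidt coefficients of $|\psi\rangle$ are not all equal. 3. For all real $k_1,\dots,k_d$ with $\sum_i C_ik_i=0$ and $\sum_i k_i^2=1$ there is a Hermitian $H$ whose imaginary part $H_I$ is antisymmetric and satisfies $H_I|\psi\rangle=\sum_i k_i|ii\rangle$, with $\langle\psi|H_IH_I^T|\psi\rangle=1$ and $\Delta E^2(\psi,H)=1$. -/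

import Mathlib

open scoped Matrix Kronecker ComplexOrder

noncomputable section

namespace EntGen

/-- A density matrix on a finite index set: positive semidefinite with unit trace. -/
def IsDensity {n : Type*} [Fintype n] (ρ : Matrix n n ℂ) : Prop :=
  ρ.PosSemidef ∧ ρ.trace = 1

/-- Separable states of a bipartite system: convex combinations of product states. -/
def separableStates (dA dB : ℕ) : Set (Matrix (Fin dA × Fin dB) (Fin dA × Fin dB) ℂ) :=
  convexHull ℝ {σ | ∃ (ρA : Matrix (Fin dA) (Fin dA) ℂ) (ρB : Matrix (Fin dB) (Fin dB) ℂ),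
    IsDensity ρA ∧ IsDensity ρB ∧ σ = ρA ⊗ₖ ρB}

/-- The finite value `tr (ρ (log ρ - log σ))` of the quantum relative entropy, for `σ` whose
support contains that of `ρ`. The logarithm is taken in the functional calculus, with
`log 0 = 0` on the kernels, so that it acts on the supports only. -/
def relEntropy {n : Type*} [Fintype n] [DecidableEq n] (ρ σ : Matrix n n ℂ) : ℝ :=
  (ρ * (cfc Real.log ρ - cfc Real.log σ)).trace.re

/-- Relative entropy of entanglement: the infimum of the relative entropy to separable states.
Separable `σ` with `ker σ` not contained in `ker ρ` have infinite relative entropy and do not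
contribute to the infimum. -/
def relEntropyEntanglement {dA dB : ℕ}
    (ρ : Matrix (Fin dA × Fin dB) (Fin dA × Fin dB) ℂ) : ℝ :=
  sInf {r : ℝ | ∃ σ ∈ separableStates dA dB,
    (∀ v : Fin dA × Fin dB → ℂ, σ *ᵥ v = 0 → ρ *ᵥ v = 0) ∧ r = relEntropy ρ σ}

/-- The state `e^{-iHt} |ψ⟩⟨ψ| e^{iHt}` at time `t`. -/
def evolvedState {dA dB : ℕ} (ψ : Fin dA × Fin dB → ℂ)
    (H : Matrix (Fin dA × Fin dB) (Fin dA × Fin dB) ℂ) (t : ℝ) :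
    Matrix (Fin dA × Fin dB) (Fin dA × Fin dB) ℂ :=
  NormedSpace.exp ((-(Complex.I * (t : ℂ))) • H) * Matrix.vecMulVec ψ (star ψ) *
    NormedSpace.exp ((Complex.I * (t : ℂ)) • H)

/-- The entanglement generation rate `Γ(ψ, H)`. -/
def rate {dA dB : ℕ} (ψ : Fin dA × Fin dB → ℂ)
    (H : Matrix (Fin dA × Fin dB) (Fin dA × Fin dB) ℂ) : ℝ :=
  deriv (fun t : ℝ => relEntropyEntanglement (evolvedState ψ H t)) 0

/-- The energy variance `⟨ψ|H²|ψ⟩ - ⟨ψ|H|ψ⟩²`. -/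
def variance {dA dB : ℕ} (ψ : Fin dA × Fin dB → ℂ)
    (H : Matrix (Fin dA × Fin dB) (Fin dA × Fin dB) ℂ) : ℝ :=
  (star ψ ⬝ᵥ ((H * H) *ᵥ ψ)).re - (star ψ ⬝ᵥ (H *ᵥ ψ)).re ^ 2

/-- The product vector `a ⊗ b`. -/
def prodVec {dA dB : ℕ} (a : EuclideanSpace ℂ (Fin dA)) (b : EuclideanSpace ℂ (Fin dB)) :
    Fin dA × Fin dB → ℂ :=
  fun p => a p.1 * b p.2

/-- The label `(i, i)` of the product basis vector `|ii⟩`, for `i < min dA dB`. -/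
def diagIdx {dA dB : ℕ} (i : Fin (min dA dB)) : Fin dA × Fin dB :=
  (Fin.castLE (min_le_left dA dB) i, Fin.castLE (min_le_right dA dB) i)

/-- `ψ = ∑ i, C i |i⟩|i⟩` is a Schmidt decomposition of `ψ`, in the orthonormal bases `e` of the
first and `f` of the second factor. Some of the coefficients may vanish. -/
structure IsSchmidt {dA dB : ℕ} (ψ : Fin dA × Fin dB → ℂ)
    (e : OrthonormalBasis (Fin dA) ℂ (EuclideanSpace ℂ (Fin dA)))
    (f : OrthonormalBasis (Fin dB) ℂ (EuclideanSpace ℂ (Fin dB)))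
    (C : Fin (min dA dB) → ℝ) : Prop where
  nonneg : ∀ i, 0 ≤ C i
  sum_eq : ψ = ∑ i, (C i : ℂ) • prodVec (e (diagIdx i).1) (f (diagIdx i).2)

/-- The matrix `H_I`: entrywise imaginary part of the matrix of `H` in the basis `e ⊗ f`. -/
def imPart {dA dB : ℕ}
    (e : OrthonormalBasis (Fin dA) ℂ (EuclideanSpace ℂ (Fin dA)))
    (f : OrthonormalBasis (Fin dB) ℂ (EuclideanSpace ℂ (Fin dB)))
    (H : Matrix (Fin dA × Fin dB) (Fin dA × Fin dB) ℂ) :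
    Matrix (Fin dA × Fin dB) (Fin dA × Fin dB) ℝ :=
  Matrix.of fun p q =>
    (star (prodVec (e p.1) (f p.2)) ⬝ᵥ (H *ᵥ prodVec (e q.1) (f q.2))).im

/-- Coordinates in the product basis of the vector `∑ i, v i |ii⟩`. -/
def diagVec {dA dB : ℕ} (v : Fin (min dA dB) → ℝ) : Fin dA × Fin dB → ℝ :=
  fun p => ∑ i, if p = diagIdx i then v i else 0

/-- The `|ii⟩` components `k i` of `H_I |ψ⟩`, where `ψ = ∑ i, C i |ii⟩`. -/
def kVec {dA dB : ℕ}
    (e : OrthonormalBasis (Fin dA) ℂ (EuclideanSpace ℂ (Fin dA)))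
    (f : OrthonormalBasis (Fin dB) ℂ (EuclideanSpace ℂ (Fin dB)))
    (C : Fin (min dA dB) → ℝ)
    (H : Matrix (Fin dA × Fin dB) (Fin dA × Fin dB) ℂ) : Fin (min dA dB) → ℝ :=
  fun i => (imPart e f H *ᵥ diagVec C) (diagIdx i)

/-- The quantity `⟨ψ|H_I H_Iᵀ|ψ⟩`, where `ψ = ∑ i, C i |ii⟩`. -/
def imVariance {dA dB : ℕ}
    (e : OrthonormalBasis (Fin dA) ℂ (EuclideanSpace ℂ (Fin dA)))
    (f : OrthonormalBasis (Fin dB) ℂ (EuclideanSpace ℂ (Fin dB)))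
    (C : Fin (min dA dB) → ℝ)
    (H : Matrix (Fin dA × Fin dB) (Fin dA × Fin dB) ℂ) : ℝ :=
  diagVec C ⬝ᵥ ((imPart e f H * (imPart e f H)ᵀ) *ᵥ diagVec C)

/-- `H` maximises the rate `Γ(ψ, ·)` among the Hermitian matrices satisfying the constraint `P`. -/
def IsRateMaximiser {dA dB : ℕ} (ψ : Fin dA × Fin dB → ℂ)
    (P : Matrix (Fin dA × Fin dB) (Fin dA × Fin dB) ℂ → Prop)
    (H : Matrix (Fin dA × Fin dB) (Fin dA × Fin dB) ℂ) : Prop :=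
  H.IsHermitian ∧ P H ∧ ∀ G, G.IsHermitian → P G → rate ψ G ≤ rate ψ H

end EntGen

end

/-! Let `c` be the coefficient matrix of the evolved vector in the fixed Schmidt bases, `R = c cᴴ`
its first marginal and `q j = R j j`. Diagonalising `R(t)` for each `t` would bring in eigenvectors
that need not vary smoothly, so the entanglement is squeezed between functions of the entries of
`c`. Dephasing the first factor gives a separable state, whence `E ≤ -∑ q j log q j`. Conversely, a
separable `σ` lies below some `S ⊗ 1` with `S` a density matrix; operator monotonicity of the
logarithm, Gibbs' inequality and `log x ≤ log τ + x/τ - 1` give `E ≥ 1 - ∑ (q j log τ j + (R²) j j /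
τ j)` for every positive `τ`. At `t = 0` the matrix `R` is diagonal, and with `τ j = q j 0` (or
`√|t|` where `q j 0 = 0`) the two bounds agree in value and derivative. This is
`hasDerivAt_entanglement_of_bounds`, and it yields the rate `-4 ∑ C i log (C i) k i`.

What remains is Euclidean geometry. Write `c` now for the real vector `diagVec C` and put `x = H_I
c`. The rate is linear in `x`; antisymmetry of `H_I` forces `x ⟂ c`; `⟨ψ|H_I H_Iᵀ|ψ⟩ = |x|²` is at
most the variance; and each `x ⟂ c` comes from a Hermitian matrix with equality
(`exists_isHermitian_imPart_mulVec_eq`). An optimal `x` is therefore antiparallel to the projection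
on `c⊥` of the vector with entries `C i log (C i)`, unless that projection vanishes, which happens
only if all nonzero `C i` coincide. -/

namespace EntGen

/-! ### Functional calculus of Hermitian matrices and the logarithm. -/

section FunctionalCalculus

variable {n : Type*} [Fintype n] [DecidableEq n]

theorem exists_unitary_diagonalization {A : Matrix n n ℂ} (hA : A.IsHermitian) :
    ∃ V : Matrix n n ℂ, Vᴴ * V = 1 ∧ V * Vᴴ = 1 ∧
      A = V * Matrix.diagonal (fun i => (hA.eigenvalues i : ℂ)) * Vᴴ ∧
      ∀ f : ℝ → ℝ, cfc f A = V * Matrix.diagonal (fun i => (f (hA.eigenvalues i) : ℂ)) * Vᴴ := by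
  refine ⟨hA.eigenvectorUnitary, ?_, ?_, ?_, ?_⟩
  · exact Unitary.coe_star_mul_self hA.eigenvectorUnitary
  · exact Unitary.coe_mul_star_self hA.eigenvectorUnitary
  · have := hA.spectral_theorem
    rw [Unitary.conjStarAlgAut_apply] at this
    exact this
  · intro f
    rw [hA.cfc_eq f, Matrix.IsHermitian.cfc, Unitary.conjStarAlgAut_apply]
    rfl

/-- In eigenbasis coordinates `v` is supported where the eigenvalue equals `μ`. -/
theorem cfc_mulVec_of_eigenvector {A : Matrix n n ℂ} (hA : A.IsHermitian) (f : ℝ → ℝ)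
    {v : n → ℂ} {μ : ℝ} (h : A *ᵥ v = (μ : ℂ) • v) :
    cfc f A *ᵥ v = (f μ : ℂ) • v := by
  obtain ⟨V, hV, hV', hAV, hf⟩ := exists_unitary_diagonalization hA
  have key : Matrix.diagonal (fun i => (f (hA.eigenvalues i) : ℂ)) *ᵥ (Vᴴ *ᵥ v)
      = (f μ : ℂ) • (Vᴴ *ᵥ v) := by
    have h1 : Matrix.diagonal (fun i => (hA.eigenvalues i : ℂ)) *ᵥ (Vᴴ *ᵥ v)
        = (μ : ℂ) • (Vᴴ *ᵥ v) := by
      rw [← Matrix.mulVec_smul, ← h]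
      nth_rewrite 2 [hAV]
      simp only [Matrix.mulVec_mulVec]
      rw [← Matrix.mul_assoc, ← Matrix.mul_assoc, hV, Matrix.one_mul]
    ext i
    have h2 := congrFun h1 i
    simp only [Matrix.mulVec_diagonal, Pi.smul_apply, smul_eq_mul] at h2 ⊢
    by_cases hz : (Vᴴ *ᵥ v) i = 0
    · simp [hz]
    · have := mul_right_cancel₀ hz h2
      rw [Complex.ofReal_inj.mp this]
  rw [hf f, Matrix.mul_assoc, ← Matrix.mulVec_mulVec, ← Matrix.mulVec_mulVec, key,
    Matrix.mulVec_smul, Matrix.mulVec_mulVec, hV', Matrix.one_mulVec]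

theorem dotProduct_mulVec_unitary_diagonal (U : Matrix n n ℂ) (μ : n → ℝ) (v : n → ℂ) :
    star v ⬝ᵥ ((U * Matrix.diagonal (fun i => (μ i : ℂ)) * Uᴴ) *ᵥ v)
      = ((∑ k, μ k * ‖(Uᴴ *ᵥ v) k‖ ^ 2 : ℝ) : ℂ) := by
  have : star v ⬝ᵥ ((U * Matrix.diagonal (fun i => (μ i : ℂ)) * Uᴴ) *ᵥ v)
      = star (Uᴴ *ᵥ v) ⬝ᵥ (Matrix.diagonal (fun i => (μ i : ℂ)) *ᵥ (Uᴴ *ᵥ v)) := by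
    rw [Matrix.star_mulVec, Matrix.conjTranspose_conjTranspose, ← Matrix.dotProduct_mulVec,
      Matrix.mulVec_mulVec, Matrix.mulVec_mulVec, Matrix.mul_assoc]
  rw [this]
  simp only [dotProduct, Matrix.mulVec_diagonal, Pi.star_apply]
  push_cast
  refine Finset.sum_congr rfl fun k _ => ?_
  rw [← Complex.conj_mul']
  simp only [RCLike.star_def]
  ring

/-- Any unitary diagonalisation computes `cfc`, since the columns of `U` are eigenvectors. This
allows product unitaries for Kronecker products. -/
theorem cfc_unitary_conj_diagonal {A U : Matrix n n ℂ} (hU : U * Uᴴ = 1) {μ : n → ℝ}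
    (hA : A = U * Matrix.diagonal (fun i => (μ i : ℂ)) * Uᴴ) (f : ℝ → ℝ) :
    cfc f A = U * Matrix.diagonal (fun i => (f (μ i) : ℂ)) * Uᴴ := by
  have hU' : Uᴴ * U = 1 := mul_eq_one_comm.mp hU
  have hAh : A.IsHermitian := by
    rw [hA, Matrix.IsHermitian]
    have : star (fun i => (μ i : ℂ)) = fun i => (μ i : ℂ) := by ext; simp
    simp [Matrix.conjTranspose_mul, Matrix.mul_assoc, Matrix.diagonal_conjTranspose, this]
  have key : cfc f A * U = U * Matrix.diagonal (fun i => (f (μ i) : ℂ)) := by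
    ext i k
    have h1 : A *ᵥ (U.col k) = (μ k : ℂ) • U.col k := by
      have : A * U = U * Matrix.diagonal (fun i => (μ i : ℂ)) := by
        rw [hA, Matrix.mul_assoc, hU', Matrix.mul_one]
      ext j
      have := congrFun (congrFun this j) k
      rw [Matrix.mul_diagonal] at this
      simp only [Pi.smul_apply, smul_eq_mul, Matrix.col_apply]
      rw [mul_comm, ← this]
      rfl
    have h2 := congrFun (cfc_mulVec_of_eigenvector hAh f h1) i
    rw [Matrix.mul_diagonal, mul_comm (U i k)]
    exact h2
  rw [← key, Matrix.mul_assoc, hU, Matrix.mul_one]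

open scoped Matrix.Norms.L2Operator MatrixOrder in
theorem cfc_log_le {A B : Matrix n n ℂ} (hA : A.PosDef) (hAB : (B - A).PosSemidef) :
    (cfc Real.log B - cfc Real.log A).PosSemidef := by
  have h : CFC.log A ≤ CFC.log B := CFC.log_le_log hAB hA.isStrictlyPositive
  exact h

/-- Adding a positive multiple of the identity increases the expectation of the logarithm, in
vectors orthogonal to the kernel. -/
theorem expect_log_le_add {A : Matrix n n ℂ} (hA : A.PosSemidef) {v : n → ℂ}
    (hv : ∀ w, A *ᵥ w = 0 → star v ⬝ᵥ w = 0) {ε : ℝ} (hε : 0 < ε) :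
    (star v ⬝ᵥ (cfc Real.log A *ᵥ v)).re ≤
      (star v ⬝ᵥ (cfc Real.log (A + (ε : ℂ) • 1) *ᵥ v)).re := by
  obtain ⟨V, hV, hV', hAV, hf⟩ := exists_unitary_diagonalization hA.1
  have h2 : A + (ε : ℂ) • 1
      = V * Matrix.diagonal (fun i => ((hA.1.eigenvalues i + ε : ℝ) : ℂ)) * Vᴴ := by
    have : Matrix.diagonal (fun i => ((hA.1.eigenvalues i + ε : ℝ) : ℂ))
        = Matrix.diagonal (fun i => (hA.1.eigenvalues i : ℂ)) + (ε : ℂ) • (1 : Matrix n n ℂ) := by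
      ext i j
      by_cases h : i = j <;> simp [h, Matrix.diagonal]
    rw [this, Matrix.mul_add, Matrix.add_mul, ← hAV]
    simp [hV']
  rw [hf, cfc_unitary_conj_diagonal hV' h2, dotProduct_mulVec_unitary_diagonal,
    dotProduct_mulVec_unitary_diagonal, Complex.ofReal_re, Complex.ofReal_re]
  refine Finset.sum_le_sum fun k _ => ?_
  -- With `log 0 = 0` the termwise inequality fails at a zero eigenvalue when `ε < 1`; there the
  -- coordinate of `v` vanishes, because that column of `V` lies in the kernel of `A`.
  rcases (hA.eigenvalues_nonneg k).eq_or_lt with h0 | h0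
  · have : (Vᴴ *ᵥ v) k = 0 := by
      have h3 : A *ᵥ V.col k = 0 := by
        have : A * V = V * Matrix.diagonal (fun i => (hA.1.eigenvalues i : ℂ)) := by
          nth_rewrite 1 [hAV]
          rw [Matrix.mul_assoc, hV, Matrix.mul_one]
        ext j
        have := congrFun (congrFun this j) k
        rw [Matrix.mul_diagonal, ← h0] at this
        have h5 : (A * V) j k = 0 := by simpa using this
        exact h5
      have h4 := congrArg star (hv _ h3)
      rw [star_zero] at h4
      rw [← h4]
      simp [Matrix.mulVec, dotProduct, mul_comm]
    simp [this]
  · exact mul_le_mul_of_nonneg_right (Real.log_le_log h0 (by linarith)) (by positivity)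

/-- The vector `v` is an eigenvector of its projector with eigenvalue `1`, so the `log ρ` term
vanishes. -/
theorem relEntropy_pure {v : n → ℂ} (hv : star v ⬝ᵥ v = 1) (σ : Matrix n n ℂ) :
    relEntropy (Matrix.vecMulVec v (star v)) σ = -(star v ⬝ᵥ (cfc Real.log σ *ᵥ v)).re := by
  have htr : ∀ X : Matrix n n ℂ,
      (Matrix.vecMulVec v (star v) * X).trace = star v ⬝ᵥ (X *ᵥ v) := by
    intro X
    rw [Matrix.vecMulVec_mul, Matrix.trace_vecMulVec, Matrix.dotProduct_mulVec, dotProduct_comm]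
  have h1 : Matrix.vecMulVec v (star v) *ᵥ v = ((1 : ℝ) : ℂ) • v := by
    rw [Matrix.vecMulVec_mulVec, hv]
    ext; simp
  have h2 := cfc_mulVec_of_eigenvector (Matrix.posSemidef_vecMulVec_self_star v).1 Real.log h1
  rw [relEntropy, htr, Matrix.sub_mulVec, h2]
  simp

end FunctionalCalculus

end EntGen

namespace EntGen

/-! ### Entropy inequalities for doubly stochastic mixing. -/

section Entropy

theorem mul_diagonal_mul_conjTranspose_apply_self {m n : Type*} [Fintype n] [DecidableEq n]
    (Z : Matrix m n ℂ) (μ : n → ℝ) (l : m) :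
    (Z * Matrix.diagonal (fun i => (μ i : ℂ)) * Zᴴ) l l = ((∑ k, ‖Z l k‖ ^ 2 * μ k : ℝ) : ℂ) := by
  rw [Matrix.mul_apply]
  push_cast
  refine Finset.sum_congr rfl fun k _ => ?_
  rw [Matrix.mul_diagonal, Matrix.conjTranspose_apply, ← Complex.mul_conj', RCLike.star_def]
  ring

theorem mul_conjTranspose_apply_self {m n : Type*} [Fintype n]
    (Z : Matrix m n ℂ) (l : m) :
    (Z * Zᴴ) l l = ((∑ k, ‖Z l k‖ ^ 2 : ℝ) : ℂ) := by
  rw [Matrix.mul_apply]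
  push_cast
  refine Finset.sum_congr rfl fun k _ => ?_
  rw [Matrix.conjTranspose_apply, ← Complex.mul_conj', RCLike.star_def]

theorem sum_norm_sq_row_of_unitary {n : Type*} [Fintype n] [DecidableEq n] {Z : Matrix n n ℂ}
    (hZ : Z * Zᴴ = 1) (l : n) : ∑ k, ‖Z l k‖ ^ 2 = 1 := by
  have := mul_conjTranspose_apply_self Z l
  rw [hZ, Matrix.one_apply_eq] at this
  exact_mod_cast this.symm

theorem sum_norm_sq_col_of_unitary {n : Type*} [Fintype n] [DecidableEq n] {Z : Matrix n n ℂ}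
    (hZ : Zᴴ * Z = 1) (k : n) : ∑ l, ‖Z l k‖ ^ 2 = 1 := by
  have := sum_norm_sq_row_of_unitary (Z := Zᴴ) (by rwa [Matrix.conjTranspose_conjTranspose]) k
  simpa using this

theorem mul_log_le_mul_log_add {x s : ℝ} (hx : 0 ≤ x) (hs : 0 < s) :
    x * Real.log s ≤ x * Real.log x + s - x := by
  rcases hx.eq_or_lt with rfl | hx
  · simp [hs.le]
  · have h := Real.log_le_sub_one_of_pos (div_pos hs hx)
    rw [Real.log_div hs.ne' hx.ne'] at h
    have h2 := mul_le_mul_of_nonneg_left h hx.le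
    have h3 : x * (s / x - 1) = s - x := by field_simp
    linarith

/-- This is `log y ≤ y - 1` at `y = x / s`. The error is quadratic in `x`, so summing over
eigenvalues produces traces of `R` and `R²` only. -/
theorem mul_log_self_le {x s : ℝ} (hx : 0 ≤ x) (hs : 0 < s) :
    x * Real.log x ≤ x * Real.log s + x ^ 2 / s - x := by
  rcases hx.eq_or_lt with rfl | hx
  · simp
  · have h := Real.log_le_sub_one_of_pos (div_pos hx hs)
    rw [Real.log_div hx.ne' hs.ne'] at h
    have h2 := mul_le_mul_of_nonneg_left h hx.le
    have h3 : x * (x / s - 1) = x ^ 2 / s - x := by field_simp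
    linarith

/-- Gibbs' inequality for the image of a distribution under a doubly stochastic matrix. -/
theorem sum_mul_log_le_of_doublyStochastic {n : Type*} [Fintype n] {P : n → n → ℝ}
    (hP : ∀ k l, 0 ≤ P k l) (hrow : ∀ k, ∑ l, P k l = 1) (hcol : ∀ l, ∑ k, P k l = 1)
    {x s : n → ℝ} (hx : ∀ k, 0 ≤ x k) (hx1 : ∑ k, x k = 1) (hs : ∀ l, 0 < s l) :
    ∑ l, (∑ k, P k l * x k) * Real.log (s l) ≤
      ∑ k, x k * Real.log (x k) + ∑ l, s l - 1 := by
  have h1 : ∑ l, (∑ k, P k l * x k) * Real.log (s l)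
      = ∑ k, ∑ l, P k l * (x k * Real.log (s l)) := by
    rw [Finset.sum_comm]
    simp only [Finset.sum_mul, mul_assoc]
  have h2 : ∑ k, x k * Real.log (x k) + ∑ l, s l - 1
      = ∑ k, ∑ l, P k l * (x k * Real.log (x k) + s l - x k) := by
    simp only [mul_add, mul_sub, Finset.sum_add_distrib, Finset.sum_sub_distrib]
    simp only [← Finset.sum_mul, hrow, one_mul, hx1]
    rw [Finset.sum_comm (f := fun k l => P k l * s l)]
    simp only [← Finset.sum_mul, hcol, one_mul]
  rw [h1, h2]
  exact Finset.sum_le_sum fun k _ => Finset.sum_le_sum fun l _ =>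
    mul_le_mul_of_nonneg_left (mul_log_le_mul_log_add (hx k) (hs l)) (hP k l)

/-- For `x` the spectrum of `R` and `P` the squared moduli of its eigenvector coordinates, the inner
sums are the diagonal entries of `R` and `R²`; the bound then no longer mentions the eigenvectors.
-/
theorem sum_mul_log_self_le_of_doublyStochastic {n : Type*} [Fintype n] {P : n → n → ℝ}
    (hP : ∀ k l, 0 ≤ P k l) (hrow : ∀ k, ∑ l, P k l = 1)
    {x s : n → ℝ} (hx : ∀ k, 0 ≤ x k) (hx1 : ∑ k, x k = 1) (hs : ∀ l, 0 < s l) :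
    ∑ k, x k * Real.log (x k) ≤
      ∑ l, (∑ k, P k l * x k) * Real.log (s l) + ∑ l, (∑ k, P k l * x k ^ 2) / s l - 1 := by
  have h1 : ∑ l, (∑ k, P k l * x k) * Real.log (s l)
      = ∑ k, ∑ l, P k l * (x k * Real.log (s l)) := by
    rw [Finset.sum_comm]
    simp only [Finset.sum_mul, mul_assoc]
  have h2 : ∑ l, (∑ k, P k l * x k ^ 2) / s l = ∑ k, ∑ l, P k l * (x k ^ 2 / s l) := by
    rw [Finset.sum_comm]
    simp only [Finset.sum_div, mul_div_assoc]
  have h3 : ∑ k, x k * Real.log (x k) = ∑ k, ∑ l, P k l * (x k * Real.log (x k)) := by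
    simp only [← Finset.sum_mul, hrow, one_mul]
  have h4 : (1 : ℝ) = ∑ k, ∑ l, P k l * x k := by
    simp only [← Finset.sum_mul, hrow, one_mul, hx1]
  rw [h1, h2, h3, h4]
  simp only [← Finset.sum_add_distrib, ← Finset.sum_sub_distrib, ← mul_add, ← mul_sub]
  exact Finset.sum_le_sum fun k _ => Finset.sum_le_sum fun l _ =>
    mul_le_mul_of_nonneg_left (mul_log_self_le (hx k) (hs l)) (hP k l)

end Entropy

/-! ### Operator domination of separable states. -/

section Separable

variable {dA dB : ℕ}

theorem IsDensity.sum_eigenvalues {n : Type*} [Fintype n] [DecidableEq n] {ρ : Matrix n n ℂ}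
    (h : IsDensity ρ) : ∑ i, h.1.1.eigenvalues i = 1 := by
  apply Complex.ofReal_injective
  push_cast
  exact (h.2.symm.trans h.1.1.trace_eq_sum_eigenvalues).symm

theorem IsDensity.posSemidef_one_sub {n : Type*} [Fintype n] [DecidableEq n] {ρ : Matrix n n ℂ}
    (h : IsDensity ρ) : (1 - ρ).PosSemidef := by
  obtain ⟨V, hV, hV', hAV, -⟩ := exists_unitary_diagonalization h.1.1
  have h2 : 1 - ρ
      = V * Matrix.diagonal (fun i => ((1 - h.1.1.eigenvalues i : ℝ) : ℂ)) * Vᴴ := by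
    have : Matrix.diagonal (fun i => ((1 - h.1.1.eigenvalues i : ℝ) : ℂ))
        = 1 - Matrix.diagonal (fun i => (h.1.1.eigenvalues i : ℂ)) := by
      ext i j
      by_cases h : i = j <;> simp [h, Matrix.diagonal]
    rw [this, Matrix.mul_sub, Matrix.sub_mul, ← hAV, Matrix.mul_one, hV']
  rw [h2]
  refine Matrix.PosSemidef.mul_mul_conjTranspose_same (Matrix.PosSemidef.diagonal fun i => ?_) V
  have : h.1.1.eigenvalues i ≤ 1 :=
    h.sum_eigenvalues ▸ Finset.single_le_sum (fun j _ => h.1.eigenvalues_nonneg j) (Finset.mem_univ i)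
  exact Complex.zero_le_real.mpr (sub_nonneg.mpr this)

/-- A separable state is dominated by its first marginal tensored with the identity. -/
theorem exists_le_kronecker_one_of_separable {σ : Matrix (Fin dA × Fin dB) (Fin dA × Fin dB) ℂ}
    (hσ : σ ∈ separableStates dA dB) :
    σ.PosSemidef ∧ ∃ S : Matrix (Fin dA) (Fin dA) ℂ, IsDensity S ∧
      (S ⊗ₖ (1 : Matrix (Fin dB) (Fin dB) ℂ) - σ).PosSemidef := by
  refine convexHull_min (t := {σ | σ.PosSemidef ∧ ∃ S : Matrix (Fin dA) (Fin dA) ℂ, IsDensity S ∧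
      (S ⊗ₖ (1 : Matrix (Fin dB) (Fin dB) ℂ) - σ).PosSemidef}) ?_ ?_ hσ
  · rintro _ ⟨ρA, ρB, hA, hB, rfl⟩
    refine ⟨hA.1.kronecker hB.1, ρA, hA, ?_⟩
    -- A density matrix satisfies `ρB ≤ 1`, so the difference is a Kronecker product of positive
    -- matrices.
    have h : ρA ⊗ₖ 1 - ρA ⊗ₖ ρB = ρA ⊗ₖ (1 - ρB) := by
      ext p q
      simp only [Matrix.sub_apply, Matrix.kroneckerMap_apply, mul_sub]
    rw [h]
    exact hA.1.kronecker hB.posSemidef_one_sub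
  · rintro x ⟨hx, S, hS, hxS⟩ y ⟨hy, T, hT, hyT⟩ a b ha hb hab
    refine ⟨(hx.smul ha).add (hy.smul hb), a • S + b • T,
      ⟨(hS.1.smul ha).add (hT.1.smul hb), ?_⟩, ?_⟩
    · simp only [Matrix.trace_add, Matrix.trace_smul, hS.2, hT.2, ← add_smul, hab, one_smul]
    · convert (hxS.smul ha).add (hyT.smul hb) using 1
      rw [Matrix.add_kronecker, Matrix.smul_kronecker, Matrix.smul_kronecker, smul_sub, smul_sub]
      abel

end Separable

end EntGen

namespace EntGen

/-! ### Bounds on the expectation of `log σ` for separable `σ`. -/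

section Bounds

variable {dA dB : ℕ}

/-- The bipartite vector with coefficient matrix `N`. -/
def vecOf (N : Matrix (Fin dA) (Fin dB) ℂ) : Fin dA × Fin dB → ℂ := fun p => N p.1 p.2

theorem conjTranspose_kronecker_one_mulVec_vecOf (T : Matrix (Fin dA) (Fin dA) ℂ)
    (N : Matrix (Fin dA) (Fin dB) ℂ) :
    (T ⊗ₖ (1 : Matrix (Fin dB) (Fin dB) ℂ))ᴴ *ᵥ vecOf N = vecOf (Tᴴ * N) := by
  ext ⟨l, m⟩
  simp only [Matrix.mulVec, dotProduct, vecOf, Matrix.mul_apply, Fintype.sum_prod_type]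
  refine Finset.sum_congr rfl fun a _ => ?_
  rw [Finset.sum_eq_single m]
  · simp
  · intro b _ hb
    simp [hb]
  · simp

/-- The shift by `ε` makes `σ + ε` positive definite, so that operator monotonicity of the logarithm
applies to `σ + ε ≤ S ⊗ 1 + ε`; `s` is the spectrum of `S`. -/
theorem expect_log_le_of_separable {N : Matrix (Fin dA) (Fin dB) ℂ}
    {σ : Matrix (Fin dA × Fin dB) (Fin dA × Fin dB) ℂ} (hσ : σ ∈ separableStates dA dB)
    (hker : ∀ w, σ *ᵥ w = 0 → star (vecOf N) ⬝ᵥ w = 0) {ε : ℝ} (hε : 0 < ε) :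
    ∃ (T : Matrix (Fin dA) (Fin dA) ℂ) (s : Fin dA → ℝ), Tᴴ * T = 1 ∧ T * Tᴴ = 1 ∧
      (∀ l, 0 ≤ s l) ∧ ∑ l, s l = 1 ∧
      (star (vecOf N) ⬝ᵥ (cfc Real.log σ *ᵥ vecOf N)).re ≤
        ∑ l, (∑ m, ‖(Tᴴ * N) l m‖ ^ 2) * Real.log (s l + ε) := by
  obtain ⟨hσp, S, hS, hle⟩ := exists_le_kronecker_one_of_separable hσ
  obtain ⟨T, hT, hT', hST, -⟩ := exists_unitary_diagonalization hS.1.1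
  set s := hS.1.1.eigenvalues with hs
  refine ⟨T, s, hT, hT', hS.1.eigenvalues_nonneg, hS.sum_eigenvalues, ?_⟩
  refine (expect_log_le_add hσp hker hε).trans ?_
  set B := S ⊗ₖ (1 : Matrix (Fin dB) (Fin dB) ℂ) + (ε : ℂ) • 1
  have hAp : (σ + (ε : ℂ) • 1).PosDef := by
    refine Matrix.PosDef.posSemidef_add hσp ?_
    have : (0 : ℂ) < ε := by exact_mod_cast hε
    exact Matrix.PosDef.one.smul this
  have hmono := cfc_log_le hAp (B := B) (by simpa [B] using hle)
  have hU : (T ⊗ₖ (1 : Matrix (Fin dB) (Fin dB) ℂ)) * (T ⊗ₖ (1 : Matrix (Fin dB) (Fin dB) ℂ))ᴴ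
      = 1 := by
    rw [Matrix.conjTranspose_kronecker, ← Matrix.mul_kronecker_mul, hT']
    simp
  have hB : B = (T ⊗ₖ (1 : Matrix (Fin dB) (Fin dB) ℂ)) *
      Matrix.diagonal (fun p : Fin dA × Fin dB => ((s p.1 + ε : ℝ) : ℂ)) *
        (T ⊗ₖ (1 : Matrix (Fin dB) (Fin dB) ℂ))ᴴ := by
    have : Matrix.diagonal (fun p : Fin dA × Fin dB => ((s p.1 + ε : ℝ) : ℂ))
        = Matrix.diagonal (fun i => (s i : ℂ)) ⊗ₖ (1 : Matrix (Fin dB) (Fin dB) ℂ)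
          + (ε : ℂ) • 1 := by
      rw [← Matrix.diagonal_one, Matrix.diagonal_kronecker_diagonal, ← Matrix.diagonal_one,
        ← Matrix.diagonal_smul, Matrix.diagonal_add]
      simp
    rw [this, Matrix.mul_add, Matrix.add_mul, Matrix.mul_smul, Matrix.mul_one, Matrix.smul_mul, hU,
      Matrix.conjTranspose_kronecker, ← Matrix.mul_kronecker_mul, ← Matrix.mul_kronecker_mul,
      ← hST]
    simp [B]
  have h1 := (hmono.dotProduct_mulVec_nonneg (vecOf N))
  rw [Matrix.sub_mulVec, dotProduct_sub] at h1
  have h2 := (Complex.le_def.mp h1).1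
  rw [Complex.zero_re, Complex.sub_re, cfc_unitary_conj_diagonal hU hB,
    dotProduct_mulVec_unitary_diagonal, Complex.ofReal_re,
    conjTranspose_kronecker_one_mulVec_vecOf, Fintype.sum_prod_type] at h2
  simp only [vecOf, ← Finset.mul_sum] at h2
  simp only [mul_comm _ (Real.log _)]
  exact sub_nonneg.mp h2

/-- Two comparisons are chained through `∑ x k log (x k)`, where `x` is the spectrum of the
marginal: Gibbs against the spectrum of `S`, then the quadratic bound against `τ`. -/
theorem expect_log_le {U : Matrix (Fin dA) (Fin dA) ℂ} (hU : Uᴴ * U = 1)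
    {W : Matrix (Fin dA) (Fin dB) ℂ} (hW : ∑ j, ∑ m, ‖W j m‖ ^ 2 = 1)
    {σ : Matrix (Fin dA × Fin dB) (Fin dA × Fin dB) ℂ} (hσ : σ ∈ separableStates dA dB)
    (hker : ∀ w, σ *ᵥ w = 0 → star (vecOf (U * W)) ⬝ᵥ w = 0)
    {τ : Fin dA → ℝ} (hτ : ∀ j, 0 < τ j) :
    (star (vecOf (U * W)) ⬝ᵥ (cfc Real.log σ *ᵥ vecOf (U * W))).re ≤
      ∑ j, (∑ m, ‖W j m‖ ^ 2) * Real.log (τ j) +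
        ∑ j, (∑ i, ‖(W * Wᴴ) j i‖ ^ 2) / τ j - 1 := by
  have hU' : U * Uᴴ = 1 := mul_eq_one_comm.mp hU
  have hR : (W * Wᴴ).PosSemidef := Matrix.posSemidef_self_mul_conjTranspose W
  obtain ⟨V, hV, hV', hRV, -⟩ := exists_unitary_diagonalization hR.1
  set x := hR.1.eigenvalues with hxdef
  have hx : ∀ k, 0 ≤ x k := hR.eigenvalues_nonneg
  have hq : ∀ j, ∑ m, ‖W j m‖ ^ 2 = ∑ k, ‖V j k‖ ^ 2 * x k := fun j => by
    have h1 := mul_conjTranspose_apply_self W j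
    rw [hRV, mul_diagonal_mul_conjTranspose_apply_self] at h1
    exact_mod_cast h1.symm
  have hx1 : ∑ k, x k = 1 := by
    rw [← hW]
    simp only [hq]
    rw [Finset.sum_comm]
    simp only [← Finset.sum_mul, sum_norm_sq_col_of_unitary hV, one_mul]
  have hR2 : ∀ j, ∑ i, ‖(W * Wᴴ) j i‖ ^ 2 = ∑ k, ‖V j k‖ ^ 2 * x k ^ 2 := fun j => by
    have h1 := mul_conjTranspose_apply_self (W * Wᴴ) j
    have h2 : W * Wᴴ * (W * Wᴴ)ᴴ
        = V * Matrix.diagonal (fun k => ((x k ^ 2 : ℝ) : ℂ)) * Vᴴ := by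
      rw [hR.1.eq]
      nth_rewrite 1 [hRV]
      nth_rewrite 1 [hRV]
      calc _ = V * Matrix.diagonal (fun i => (x i : ℂ)) * (Vᴴ * V) *
            Matrix.diagonal (fun i => (x i : ℂ)) * Vᴴ := by simp only [Matrix.mul_assoc]
        _ = _ := by
          rw [hV, Matrix.mul_one, Matrix.mul_assoc V, Matrix.diagonal_mul_diagonal]
          simp [pow_two]
    rw [h2, mul_diagonal_mul_conjTranspose_apply_self] at h1
    exact_mod_cast h1.symm
  have hB := sum_mul_log_self_le_of_doublyStochastic (P := fun k j => ‖V j k‖ ^ 2)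
    (fun _ _ => by positivity) (sum_norm_sq_col_of_unitary hV) hx hx1 hτ
  simp only [← hq, ← hR2] at hB
  refine le_trans (le_of_forall_pos_le_add fun δ hδ => ?_) hB
  -- The shifted spectrum of `S` has total mass `1 + dA * ε`, and this `ε` keeps the excess below
  -- `δ`, also when `dA = 0`.
  have hε : 0 < δ / (dA + 1) := by positivity
  obtain ⟨T, s, hT, hT', hs, hs1, hle⟩ := expect_log_le_of_separable hσ hker hε
  refine hle.trans ?_
  -- Transition matrix between the eigenbases of `S` and of the marginal `U W Wᴴ Uᴴ`; its squared
  -- moduli are doubly stochastic.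
  set Z := Tᴴ * U * V with hZ
  have hZ1 : Zᴴ * Z = 1 := by
    calc Zᴴ * Z = Vᴴ * (Uᴴ * (T * Tᴴ) * U) * V := by
          simp only [hZ, Matrix.conjTranspose_mul, Matrix.conjTranspose_conjTranspose,
            Matrix.mul_assoc]
      _ = 1 := by rw [hT', Matrix.mul_one, hU, Matrix.mul_one, hV]
  have hZ2 : Z * Zᴴ = 1 := mul_eq_one_comm.mp hZ1
  have hqT : ∀ l, ∑ m, ‖(Tᴴ * (U * W)) l m‖ ^ 2 = ∑ k, ‖Z l k‖ ^ 2 * x k := fun l => by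
    have h1 := mul_conjTranspose_apply_self (Tᴴ * (U * W)) l
    have h2 : Tᴴ * (U * W) * (Tᴴ * (U * W))ᴴ
        = Z * Matrix.diagonal (fun k => (x k : ℂ)) * Zᴴ := by
      calc _ = Tᴴ * U * (W * Wᴴ) * Uᴴ * T := by
            simp only [Matrix.conjTranspose_mul, Matrix.conjTranspose_conjTranspose,
              Matrix.mul_assoc]
        _ = _ := by
          rw [hRV]
          simp only [hZ, Matrix.conjTranspose_mul, Matrix.conjTranspose_conjTranspose,
              Matrix.mul_assoc]
    rw [h2, mul_diagonal_mul_conjTranspose_apply_self] at h1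
    exact_mod_cast h1.symm
  simp only [hqT]
  have hA := sum_mul_log_le_of_doublyStochastic (P := fun k l => ‖Z l k‖ ^ 2)
    (s := fun l => s l + δ / (dA + 1)) (fun _ _ => by positivity)
    (sum_norm_sq_col_of_unitary hZ1) (sum_norm_sq_row_of_unitary hZ2) hx hx1
    (fun l => add_pos_of_nonneg_of_pos (hs l) hε)
  refine hA.trans ?_
  rw [Finset.sum_add_distrib, hs1]
  simp only [Finset.sum_const, Finset.card_univ, Fintype.card_fin, nsmul_eq_mul]
  have : (dA : ℝ) * (δ / (dA + 1)) ≤ δ := by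
    rw [mul_div_assoc', div_le_iff₀ (by positivity)]
    nlinarith
  linarith

/-- The separable state obtained by dephasing the first factor of a pure state. -/
theorem exists_separable_expect_log {U : Matrix (Fin dA) (Fin dA) ℂ} (hU : Uᴴ * U = 1)
    {W : Matrix (Fin dA) (Fin dB) ℂ} (hW : ∑ j, ∑ m, ‖W j m‖ ^ 2 = 1) :
    ∃ σ ∈ separableStates dA dB,
      (∀ w, σ *ᵥ w = 0 → star (vecOf (U * W)) ⬝ᵥ w = 0) ∧
      (star (vecOf (U * W)) ⬝ᵥ (cfc Real.log σ *ᵥ vecOf (U * W))).re =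
        ∑ j, (∑ m, ‖W j m‖ ^ 2) * Real.log (∑ m, ‖W j m‖ ^ 2) := by
  set q : Fin dA → ℝ := fun j => ∑ m, ‖W j m‖ ^ 2 with hq
  have hq0 : ∀ j, 0 ≤ q j := fun j => Finset.sum_nonneg fun m _ => by positivity
  have hqW : ∀ j, star (W j) ⬝ᵥ W j = (q j : ℂ) := fun j => by
    simp only [hq, dotProduct]
    push_cast
    exact Finset.sum_congr rfl fun m _ => by
      rw [← Complex.conj_mul', Pi.star_apply, RCLike.star_def]
  have hqz : ∀ j, q j = 0 → W j = 0 := fun j h => by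
    have := hqW j
    rw [h, Complex.ofReal_zero] at this
    exact dotProduct_star_self_eq_zero.mp this
  set u : Fin dA → Fin dA × Fin dB → ℂ := fun j p => U p.1 j * W j p.2 with hu
  have horth : ∀ i j, star (u i) ⬝ᵥ u j = if i = j then (q j : ℂ) else 0 := fun i j => by
    have h1 : star (u i) ⬝ᵥ u j = (Uᴴ * U) i j * (star (W i) ⬝ᵥ W j) := by
      simp only [dotProduct, Matrix.mul_apply, Fintype.sum_prod_type, Finset.sum_mul_sum]
      refine Finset.sum_congr rfl fun a _ => Finset.sum_congr rfl fun b _ => ?_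
      simp only [hu, Pi.star_apply, star_mul', Matrix.conjTranspose_apply]
      ring
    rw [h1, hU, Matrix.one_apply]
    split_ifs with h
    · rw [h, hqW, one_mul]
    · rw [zero_mul]
  set σ : Matrix (Fin dA × Fin dB) (Fin dA × Fin dB) ℂ :=
    ∑ j, Matrix.vecMulVec (u j) (star (u j)) with hσ
  have hφ : vecOf (U * W) = ∑ j, u j := by
    ext p
    simp [vecOf, hu, Matrix.mul_apply]
  -- The `u j` are pairwise orthogonal product vectors summing to the state, hence eigenvectors of
  -- `σ` with eigenvalues `q j`.
  have hσu : ∀ j, σ *ᵥ u j = (q j : ℂ) • u j := fun j => by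
    rw [hσ, Matrix.sum_mulVec, Finset.sum_eq_single j]
    · rw [Matrix.vecMulVec_mulVec, horth, if_pos rfl]
      ext; simp [mul_comm]
    · intro i _ hij
      rw [Matrix.vecMulVec_mulVec, horth, if_neg hij]
      simp
    · simp
  have hσh : σ.PosSemidef :=
    Matrix.posSemidef_sum _ fun j _ => Matrix.posSemidef_vecMulVec_self_star (u j)
  have hu0 : ∀ j, q j = 0 → u j = 0 := fun j h => by
    ext p
    simp [hu, hqz j h]
  refine ⟨σ, ?_, ?_, ?_⟩
  · have hσ' : σ = ∑ j ∈ Finset.univ.filter (fun j => q j ≠ 0),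
        q j • (Matrix.vecMulVec (U.col j) (star (U.col j)) ⊗ₖ
          ((q j)⁻¹ • Matrix.vecMulVec (W j) (star (W j)))) := by
      rw [Finset.sum_filter]
      refine Finset.sum_congr rfl fun j _ => ?_
      split_ifs with h
      · rw [Matrix.kronecker_smul, smul_smul, mul_inv_cancel₀ h, one_smul]
        ext p r
        simp only [hu, Matrix.vecMulVec_apply, Matrix.kroneckerMap_apply, Matrix.col_apply,
          Pi.star_apply, star_mul']
        ring
      · rw [hu0 j (not_not.mp h)]
        simp
    rw [hσ']
    refine (convex_convexHull ℝ _).sum_mem (fun j _ => hq0 j) ?_ fun j hj => ?_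
    · rw [Finset.sum_filter_ne_zero, hW]
    · refine subset_convexHull ℝ _ ⟨_, _, ⟨Matrix.posSemidef_vecMulVec_self_star _, ?_⟩,
        ⟨(Matrix.posSemidef_vecMulVec_self_star _).smul (inv_nonneg.mpr (hq0 j)), ?_⟩, rfl⟩
      · rw [Matrix.trace_vecMulVec, dotProduct_comm]
        have := congrFun (congrFun hU j) j
        rw [Matrix.one_apply_eq, Matrix.mul_apply] at this
        exact this
      · rw [Matrix.trace_smul, Matrix.trace_vecMulVec, dotProduct_comm, hqW]
        have h : q j ≠ 0 := (Finset.mem_filter.mp hj).2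
        rw [Complex.real_smul, ← Complex.ofReal_mul, inv_mul_cancel₀ h, Complex.ofReal_one]
  · intro w hw
    rw [hφ, star_sum, sum_dotProduct]
    refine Finset.sum_eq_zero fun j _ => ?_
    by_cases h : q j = 0
    · simp [hu0 j h]
    · have h1 : star (σ *ᵥ u j) ⬝ᵥ w = 0 := by
        rw [Matrix.star_mulVec, hσh.1.eq, ← Matrix.dotProduct_mulVec, hw, dotProduct_zero]
      rw [hσu, star_smul, smul_dotProduct, smul_eq_mul] at h1
      exact (mul_eq_zero.mp h1).resolve_left (by simpa using h)
  · have h1 : cfc Real.log σ *ᵥ vecOf (U * W) = ∑ j, (Real.log (q j) : ℂ) • u j := by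
      rw [hφ, Matrix.mulVec_sum]
      exact Finset.sum_congr rfl fun j _ => cfc_mulVec_of_eigenvector hσh.1 _ (hσu j)
    rw [h1, hφ, star_sum, sum_dotProduct]
    simp only [dotProduct_sum, dotProduct_smul, horth, smul_eq_mul, mul_ite, mul_zero,
      Finset.sum_ite_eq, Finset.mem_univ, if_true, ← Complex.ofReal_mul, Complex.re_sum,
      Complex.ofReal_re]
    exact Finset.sum_congr rfl fun j _ => mul_comm _ _

end Bounds

end EntGen

namespace EntGen

/-! ### Two-sided bounds on the entanglement of a pure state. -/

section PureState

variable {dA dB : ℕ}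

theorem kronecker_mulVec_vecOf (U : Matrix (Fin dA) (Fin dA) ℂ) (V : Matrix (Fin dB) (Fin dB) ℂ)
    (c : Matrix (Fin dA) (Fin dB) ℂ) : (U ⊗ₖ V) *ᵥ vecOf c = vecOf (U * (c * Vᵀ)) := by
  ext ⟨a, b⟩
  simp only [Matrix.mulVec, dotProduct, vecOf, Matrix.mul_apply, Fintype.sum_prod_type,
    Matrix.kroneckerMap_apply, Matrix.transpose_apply, Finset.mul_sum]
  refine Finset.sum_congr rfl fun i _ => Finset.sum_congr rfl fun j _ => ?_
  ring

theorem star_dotProduct_self {n : Type*} [Fintype n] (v : n → ℂ) :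
    star v ⬝ᵥ v = ((∑ p, ‖v p‖ ^ 2 : ℝ) : ℂ) := by
  simp only [dotProduct]
  push_cast
  refine Finset.sum_congr rfl fun p _ => ?_
  rw [← Complex.conj_mul', Pi.star_apply, RCLike.star_def]

theorem star_mulVec_dotProduct_mulVec_of_isometry {m n : Type*} [Fintype m] [Fintype n]
    [DecidableEq n] {U : Matrix m n ℂ} (hU : Uᴴ * U = 1) (v w : n → ℂ) :
    star (U *ᵥ v) ⬝ᵥ (U *ᵥ w) = star v ⬝ᵥ w := by
  rw [Matrix.star_mulVec, ← Matrix.dotProduct_mulVec, Matrix.mulVec_mulVec, hU, Matrix.one_mulVec]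

theorem vecMulVec_star_mulVec_eq_zero_iff {n : Type*} [Fintype n] {v : n → ℂ}
    (hv : star v ⬝ᵥ v = 1) (w : n → ℂ) :
    Matrix.vecMulVec v (star v) *ᵥ w = 0 ↔ star v ⬝ᵥ w = 0 := by
  rw [Matrix.vecMulVec_mulVec]
  constructor
  · intro h
    have h1 := congrArg (star v ⬝ᵥ ·) h
    simpa [hv] using h1
  · intro h
    simp [h]

variable {U : Matrix (Fin dA) (Fin dA) ℂ} {V : Matrix (Fin dB) (Fin dB) ℂ}
  {c : Matrix (Fin dA) (Fin dB) ℂ}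

theorem mul_transpose_mul_conjTranspose_of_unitary (hV : Vᴴ * V = 1) :
    (c * Vᵀ) * (c * Vᵀ)ᴴ = c * cᴴ := by
  have h : Vᵀ * (Vᵀ)ᴴ = 1 := by
    have h2 := congrArg Matrix.transpose hV
    rw [Matrix.transpose_mul, Matrix.transpose_one] at h2
    rw [← h2]
    rfl
  rw [Matrix.conjTranspose_mul, Matrix.mul_assoc, ← Matrix.mul_assoc Vᵀ, h, Matrix.one_mul]

theorem sum_norm_sq_mul_transpose_of_unitary (hV : Vᴴ * V = 1) (j : Fin dA) :
    ∑ m, ‖(c * Vᵀ) j m‖ ^ 2 = ∑ m, ‖c j m‖ ^ 2 := by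
  have h1 := mul_conjTranspose_apply_self (c * Vᵀ) j
  rw [mul_transpose_mul_conjTranspose_of_unitary hV, mul_conjTranspose_apply_self] at h1
  exact_mod_cast h1.symm

theorem star_vecOf_dotProduct_self (hU : Uᴴ * U = 1) (hV : Vᴴ * V = 1) :
    star ((U ⊗ₖ V) *ᵥ vecOf c) ⬝ᵥ ((U ⊗ₖ V) *ᵥ vecOf c) =
      ((∑ j, ∑ m, ‖c j m‖ ^ 2 : ℝ) : ℂ) := by
  rw [star_mulVec_dotProduct_mulVec_of_isometry, star_dotProduct_self, Fintype.sum_prod_type]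
  · rfl
  · rw [Matrix.conjTranspose_kronecker, ← Matrix.mul_kronecker_mul, hU, hV, Matrix.one_kronecker_one]

theorem le_relEntropy_of_pure (hU : Uᴴ * U = 1) (hV : Vᴴ * V = 1)
    (hc : ∑ j, ∑ m, ‖c j m‖ ^ 2 = 1) {τ : Fin dA → ℝ} (hτ : ∀ j, 0 < τ j)
    {φ : Fin dA × Fin dB → ℂ} (hφ : φ = (U ⊗ₖ V) *ᵥ vecOf c) {r : ℝ}
    (hr : ∃ σ ∈ separableStates dA dB,
      (∀ v : Fin dA × Fin dB → ℂ, σ *ᵥ v = 0 → Matrix.vecMulVec φ (star φ) *ᵥ v = 0) ∧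
        r = relEntropy (Matrix.vecMulVec φ (star φ)) σ) :
    -(∑ j, ((∑ m, ‖c j m‖ ^ 2) * Real.log (τ j) + (∑ i, ‖(c * cᴴ) j i‖ ^ 2) / τ j) - 1) ≤ r := by
  obtain ⟨σ, hσ, hker, rfl⟩ := hr
  have h1 : star φ ⬝ᵥ φ = 1 := by
    rw [hφ, star_vecOf_dotProduct_self hU hV, hc, Complex.ofReal_one]
  rw [relEntropy_pure h1, neg_le_neg_iff, hφ, kronecker_mulVec_vecOf, Finset.sum_add_distrib]
  simp only [vecMulVec_star_mulVec_eq_zero_iff h1] at hker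
  rw [hφ, kronecker_mulVec_vecOf] at hker
  refine (expect_log_le hU ?_ hσ hker hτ).trans_eq ?_
  · simpa only [sum_norm_sq_mul_transpose_of_unitary hV] using hc
  · simp only [sum_norm_sq_mul_transpose_of_unitary hV,
      mul_transpose_mul_conjTranspose_of_unitary hV]

theorem exists_relEntropy_eq_of_pure (hU : Uᴴ * U = 1) (hV : Vᴴ * V = 1)
    (hc : ∑ j, ∑ m, ‖c j m‖ ^ 2 = 1)
    {φ : Fin dA × Fin dB → ℂ} (hφ : φ = (U ⊗ₖ V) *ᵥ vecOf c) :
    ∃ σ ∈ separableStates dA dB,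
      (∀ v : Fin dA × Fin dB → ℂ, σ *ᵥ v = 0 → Matrix.vecMulVec φ (star φ) *ᵥ v = 0) ∧
        ∑ j, Real.negMulLog (∑ m, ‖c j m‖ ^ 2) = relEntropy (Matrix.vecMulVec φ (star φ)) σ := by
  have h1 : star φ ⬝ᵥ φ = 1 := by
    rw [hφ, star_vecOf_dotProduct_self hU hV, hc, Complex.ofReal_one]
  obtain ⟨σ, hσ, hker, hval⟩ := exists_separable_expect_log hU (W := c * Vᵀ)
    (by simpa only [sum_norm_sq_mul_transpose_of_unitary hV] using hc)
  rw [← kronecker_mulVec_vecOf, ← hφ] at hker hval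
  refine ⟨σ, hσ, fun v hv => (vecMulVec_star_mulVec_eq_zero_iff h1 v).mpr (hker v hv), ?_⟩
  rw [relEntropy_pure h1, hval]
  simp only [sum_norm_sq_mul_transpose_of_unitary hV, Real.negMulLog, neg_mul,
    Finset.sum_neg_distrib]

theorem relEntropyEntanglement_pure_le (hU : Uᴴ * U = 1) (hV : Vᴴ * V = 1)
    (hc : ∑ j, ∑ m, ‖c j m‖ ^ 2 = 1)
    {φ : Fin dA × Fin dB → ℂ} (hφ : φ = (U ⊗ₖ V) *ᵥ vecOf c) :
    relEntropyEntanglement (Matrix.vecMulVec φ (star φ)) ≤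
      ∑ j, Real.negMulLog (∑ m, ‖c j m‖ ^ 2) :=
  -- The choice `τ = 1` supplies the lower bound that makes the real infimum meaningful.
  csInf_le ⟨_, fun _ hr => le_relEntropy_of_pure hU hV hc (τ := fun _ => 1) (fun _ => one_pos)
    hφ hr⟩ (exists_relEntropy_eq_of_pure hU hV hc hφ)

theorem le_relEntropyEntanglement_pure (hU : Uᴴ * U = 1) (hV : Vᴴ * V = 1)
    (hc : ∑ j, ∑ m, ‖c j m‖ ^ 2 = 1) {τ : Fin dA → ℝ} (hτ : ∀ j, 0 < τ j)
    {φ : Fin dA × Fin dB → ℂ} (hφ : φ = (U ⊗ₖ V) *ᵥ vecOf c) :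
    -(∑ j, ((∑ m, ‖c j m‖ ^ 2) * Real.log (τ j) + (∑ i, ‖(c * cᴴ) j i‖ ^ 2) / τ j) - 1) ≤
      relEntropyEntanglement (Matrix.vecMulVec φ (star φ)) :=
  le_csInf ⟨_, exists_relEntropy_eq_of_pure hU hV hc hφ⟩ fun _ hr =>
    le_relEntropy_of_pure hU hV hc hτ hφ hr

end PureState

/-! ### Squeezing derivatives and first-order estimates. -/

section Calculus

open Asymptotics Filter Topology

theorem hasDerivAt_of_squeeze {l E u : ℝ → ℝ} {D x : ℝ} (hl : ∀ t, l t ≤ E t) (hu : ∀ t, E t ≤ u t)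
    (h0 : l x = u x) (hl' : HasDerivAt l D x) (hu' : HasDerivAt u D x) : HasDerivAt E D x := by
  rw [hasDerivAt_iff_isLittleO] at *
  refine IsBigO.trans_isLittleO (IsBigO.of_bound 1 (Eventually.of_forall fun t => ?_))
    (hl'.norm_left.add hu'.norm_left)
  have hE : E x = u x := le_antisymm (hu x) (h0 ▸ hl x)
  have h1 := hl t
  have h2 := hu t
  rw [one_mul, h0, hE]
  simp only [Real.norm_eq_abs, smul_eq_mul]
  refine le_trans ?_ (le_abs_self _)
  rw [abs_le]
  have h3 := neg_abs_le (l t - u x - (t - x) * D)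
  have h4 := le_abs_self (u t - u x - (t - x) * D)
  have h5 := abs_nonneg (l t - u x - (t - x) * D)
  have h6 := abs_nonneg (u t - u x - (t - x) * D)
  constructor <;> linarith

theorem hasDerivAt_zero_of_isLittleO {f : ℝ → ℝ} (hf : f =o[𝓝 0] (fun t : ℝ => t)) :
    HasDerivAt f 0 0 := by
  rw [hasDerivAt_iff_isLittleO]
  have h0 : f 0 = 0 := by
    have := (hf.isBigO.eq_zero_imp).self_of_nhds
    exact this rfl
  simpa [h0] using hf

/-- Since `√q = O(t)` and `√q log √q → 0`, their product is `o(t)`. -/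
theorem isLittleO_negMulLog_of_isBigO_sq {q : ℝ → ℝ} (hq0 : ∀ t, 0 ≤ q t)
    (hq : q =O[𝓝 0] (fun t : ℝ => t ^ 2)) :
    (fun t => Real.negMulLog (q t)) =o[𝓝 0] (fun t : ℝ => t) := by
  have h1 : (fun t => √(q t)) =O[𝓝 0] (fun t : ℝ => t) := by
    obtain ⟨K, hK⟩ := hq.bound
    refine IsBigO.of_bound (√K) (hK.mono fun t ht => ?_)
    rw [Real.norm_of_nonneg (Real.sqrt_nonneg _)]
    rw [Real.norm_of_nonneg (hq0 t), Real.norm_of_nonneg (sq_nonneg t)] at ht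
    calc √(q t) ≤ √(K * t ^ 2) := Real.sqrt_le_sqrt ht
      _ = √K * ‖t‖ := by rw [Real.sqrt_mul' _ (sq_nonneg t), Real.sqrt_sq_eq_abs, Real.norm_eq_abs]
  have h2 : (fun t => √(q t) * Real.log (√(q t))) =o[𝓝 0] (fun _ : ℝ => (1 : ℝ)) := by
    rw [isLittleO_one_iff]
    have h3 : Tendsto (fun t => √(q t)) (𝓝 0) (𝓝 0) := h1.trans_tendsto tendsto_id
    have h4 := (Real.continuous_mul_log.tendsto 0).comp h3
    simpa [Function.comp_def] using h4
  have h5 := (h1.mul_isLittleO h2).const_mul_left (-2)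
  refine (h5.congr_left fun t => ?_).congr_right fun t => mul_one t
  have h6 : Real.log (q t) = 2 * Real.log √(q t) := by rw [Real.log_sqrt (hq0 t)]; ring
  rw [Real.negMulLog, h6]
  linear_combination (-2 * Real.log √(q t)) * Real.mul_self_sqrt (hq0 t)

theorem isLittleO_mul_log_sqrt_abs {q : ℝ → ℝ} (hq : q =O[𝓝 0] (fun t : ℝ => t ^ 2)) :
    (fun t => q t * Real.log √|t|) =o[𝓝 0] (fun t : ℝ => t) := by
  have h2 : (fun t : ℝ => t * Real.log t) =o[𝓝 0] (fun _ : ℝ => (1 : ℝ)) := by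
    rw [isLittleO_one_iff]
    simpa using Real.continuous_mul_log.tendsto 0
  have h3 := ((isBigO_refl (fun t : ℝ => t) (𝓝 0)).mul_isLittleO h2).const_mul_left (1 / 2)
  refine (hq.mul (isBigO_refl _ _)).trans_isLittleO
    ((h3.congr_left fun t => ?_).congr_right fun t => mul_one t)
  rw [Real.log_sqrt (abs_nonneg t), Real.log_abs]
  ring

theorem isLittleO_div_sqrt_abs {q : ℝ → ℝ} (hq : q =O[𝓝 0] (fun t : ℝ => t ^ 2)) :
    (fun t => q t / √|t|) =o[𝓝 0] (fun t : ℝ => t) := by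
  have h2 : (fun t : ℝ => √|t|) =o[𝓝 0] (fun _ : ℝ => (1 : ℝ)) := by
    rw [isLittleO_one_iff]
    have : Continuous fun t : ℝ => √|t| := by fun_prop
    simpa using this.tendsto 0
  have h3 := (isBigO_refl (fun t : ℝ => |t|) (𝓝 0)).mul_isLittleO h2
  have h4 : (fun t : ℝ => |t| * √|t|) =o[𝓝 0] (fun t : ℝ => t) :=
    (h3.congr_right fun t => mul_one |t|).abs_right.congr_right (fun t => abs_abs t)
      |>.trans_isBigO (isBigO_refl (fun t : ℝ => t) (𝓝 0)).abs_left
  simp only [div_eq_mul_inv]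
  refine (hq.mul (isBigO_refl (fun t : ℝ => (√|t|)⁻¹) _)).trans_isLittleO (h4.congr_left fun t => ?_)
  rw [← sq_abs]
  by_cases ht : t = 0
  · simp [ht]
  · have h5 : 0 < √|t| := Real.sqrt_pos.mpr (abs_pos.mpr ht)
    rw [eq_mul_inv_iff_mul_eq₀ h5.ne', mul_assoc, Real.mul_self_sqrt (abs_nonneg t), sq]

theorem isBigO_norm_sq_of_hasDerivAt {F : Type*} [NormedAddCommGroup F] [NormedSpace ℝ F]
    {g : ℝ → F} {g' : F} (hg : HasDerivAt g g' 0) (h0 : g 0 = 0) :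
    (fun t => ‖g t‖ ^ 2) =O[𝓝 0] (fun t : ℝ => t ^ 2) := by
  have h1 := hg.differentiableAt.isBigO_sub
  simp only [h0, sub_zero] at h1
  exact h1.norm_left.pow 2

end Calculus

end EntGen

/-! ### Differentiability of a function squeezed by the entropy bounds. -/

namespace EntGen

open Asymptotics Filter Topology

variable {dA dB : ℕ}

theorem hasDerivAt_entanglement_of_bounds {c : ℝ → Matrix (Fin dA) (Fin dB) ℂ}
    {c' : Matrix (Fin dA) (Fin dB) ℂ} (hc : ∀ i m, HasDerivAt (fun t => c t i m) (c' i m) 0)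
    (hunit : ∀ t, ∑ j, ∑ m, ‖c t j m‖ ^ 2 = 1)
    (hdiag : ∀ i j, i ≠ j → (c 0 * (c 0)ᴴ) i j = 0) {E : ℝ → ℝ}
    (hE : ∀ t, E t ≤ ∑ j, Real.negMulLog (∑ m, ‖c t j m‖ ^ 2))
    (hE' : ∀ t, ∀ τ : Fin dA → ℝ, (∀ j, 0 < τ j) →
      -(∑ j, ((∑ m, ‖c t j m‖ ^ 2) * Real.log (τ j) + (∑ i, ‖(c t * (c t)ᴴ) j i‖ ^ 2) / τ j) - 1)
        ≤ E t) :
    HasDerivAt E (-∑ j, (∑ m, 2 * inner ℝ (c 0 j m) (c' j m)) *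
      Real.log (∑ m, ‖c 0 j m‖ ^ 2)) 0 := by
  set q : Fin dA → ℝ → ℝ := fun j t => ∑ m, ‖c t j m‖ ^ 2 with hq
  set r : Fin dA → ℝ := fun j => ∑ m, 2 * inner ℝ (c 0 j m) (c' j m) with hr
  set s : Fin dA → ℝ → ℝ := fun j t => ∑ i, ‖(c t * (c t)ᴴ) j i‖ ^ 2 with hs
  have hq0 : ∀ j t, 0 ≤ q j t := fun j t => Finset.sum_nonneg fun m _ => by positivity
  have hq' : ∀ j, HasDerivAt (q j) (r j) 0 := fun j =>
    HasDerivAt.fun_sum fun m _ => (hc j m).norm_sq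
  have hqsum : ∑ j, q j 0 = 1 := hunit 0
  have hr0 : ∑ j, r j = 0 := by
    have h1 : HasDerivAt (fun t => ∑ j, q j t) (∑ j, r j) 0 := HasDerivAt.fun_sum fun j _ => hq' j
    have h2 : (fun t => ∑ j, q j t) = fun _ => 1 := funext hunit
    rw [h2] at h1
    exact h1.unique (hasDerivAt_const 0 1)
  have hR : ∀ j i, ∃ R', HasDerivAt (fun t => (c t * (c t)ᴴ) j i) R' 0 := fun j i => by
    refine ⟨_, HasDerivAt.congr_deriv (f' := _) (HasDerivAt.fun_sum (u := Finset.univ)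
      fun m _ => (hc j m).mul (hc i m).star) rfl⟩
  have hRjj : ∀ j t, ‖(c t * (c t)ᴴ) j j‖ ^ 2 = q j t ^ 2 := fun j t => by
    rw [mul_conjTranspose_apply_self, Complex.norm_real, Real.norm_of_nonneg (hq0 j t)]
  -- Off-diagonal entries of `R` vanish at `0`, so their squared moduli have zero derivative there.
  have hs' : ∀ j, HasDerivAt (s j) (2 * q j 0 * r j) 0 := fun j => by
    have h1 : s j = fun t => q j t ^ 2 + ∑ i ∈ Finset.univ.erase j, ‖(c t * (c t)ᴴ) j i‖ ^ 2 := by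
      ext t
      simp only [hs]
      rw [← Finset.add_sum_erase _ _ (Finset.mem_univ j), hRjj]
    rw [h1]
    have h2 : HasDerivAt (fun t => ∑ i ∈ Finset.univ.erase j, ‖(c t * (c t)ᴴ) j i‖ ^ 2)
        (∑ i ∈ Finset.univ.erase j, 0) 0 := by
      refine HasDerivAt.fun_sum fun i hi => ?_
      obtain ⟨R', hR'⟩ := hR j i
      have h3 := hR'.norm_sq
      rwa [hdiag j i (Finset.ne_of_mem_erase hi).symm, inner_zero_left, mul_zero] at h3
    refine (((hq' j).fun_pow 2).fun_add h2).congr_deriv ?_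
    simp
  have hsq0 : ∀ j, s j 0 = q j 0 ^ 2 := fun j => by
    simp only [hs]
    rw [Finset.sum_eq_single j (fun i _ hi => by rw [hdiag j i hi.symm]; simp) (by simp), hRjj]
  have hcz : ∀ j, q j 0 = 0 → ∀ m, c 0 j m = 0 := fun j h m => by
    have := (Finset.sum_eq_zero_iff_of_nonneg (fun m _ => by positivity)).mp h m (Finset.mem_univ m)
    simpa using this
  have hrz : ∀ j, q j 0 = 0 → r j = 0 := fun j h => by
    simp [hr, hcz j h]
  have hqO : ∀ j, q j 0 = 0 → q j =O[𝓝 0] (fun t : ℝ => t ^ 2) := fun j h =>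
    IsBigO.fun_sum fun m _ => isBigO_norm_sq_of_hasDerivAt (hc j m) (hcz j h m)
  have hsO : ∀ j, q j 0 = 0 → s j =O[𝓝 0] (fun t : ℝ => t ^ 2) := fun j h =>
    IsBigO.fun_sum fun i _ => by
      obtain ⟨R', hR'⟩ := hR j i
      refine isBigO_norm_sq_of_hasDerivAt hR' ?_
      simp [Matrix.mul_apply, hcz j h]
  -- On rows vanishing at `0` both `q j` and `s j` are `O(t²)`. The scale `√|t|` makes `q j log τ`
  -- and `s j / τ` both `o(t)`; the value `1` at `t = 0` only keeps `τ` positive.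
  let τ : ℝ → Fin dA → ℝ := fun t j =>
    if q j 0 = 0 then (if t = 0 then 1 else √|t|) else q j 0
  have hτ : ∀ t j, 0 < τ t j := fun t j => by
    simp only [τ]
    split_ifs with h1 h2
    · exact one_pos
    · exact Real.sqrt_pos.mpr (abs_pos.mpr h2)
    · exact (hq0 j 0).lt_of_ne' h1
  refine hasDerivAt_of_squeeze (fun t => hE' t (τ t) (hτ t)) hE ?_ ?_ ?_
  · have h1 : ∀ j, q j 0 * Real.log (τ 0 j) + s j 0 / τ 0 j =
        -Real.negMulLog (q j 0) + q j 0 := fun j => by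
      rw [hsq0]
      by_cases h : q j 0 = 0
      · simp [h]
      · simp only [τ, if_neg h, Real.negMulLog]
        field_simp
    change -(∑ j, (q j 0 * Real.log (τ 0 j) + s j 0 / τ 0 j) - 1) = ∑ j, Real.negMulLog (q j 0)
    simp only [h1, Finset.sum_add_distrib, Finset.sum_neg_distrib, hqsum]
    ring
  · have h1 : ∀ j, HasDerivAt (fun t => q j t * Real.log (τ t j) + s j t / τ t j)
        (r j * Real.log (q j 0) + 2 * r j) 0 := fun j => by
      by_cases h : q j 0 = 0
      · have h2 : (fun t => q j t * Real.log (τ t j) + s j t / τ t j) =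
            fun t => q j t * Real.log √|t| + s j t / √|t| := by
          ext t
          by_cases ht : t = 0
          · simp [ht, τ, h, hsq0]
          · simp [ht, τ, h]
        rw [h2, hrz j h]
        simpa using hasDerivAt_zero_of_isLittleO
          ((isLittleO_mul_log_sqrt_abs (hqO j h)).add (isLittleO_div_sqrt_abs (hsO j h)))
      · simp only [τ, if_neg h]
        refine (((hq' j).mul_const _).add ((hs' j).div_const (q j 0))).congr_deriv ?_
        field_simp
    refine (((HasDerivAt.fun_sum fun j _ => h1 j).sub_const 1).neg).congr_deriv ?_
    -- The surplus `2 * r j` sums to zero because the norm is conserved.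
    rw [Finset.sum_add_distrib, ← Finset.mul_sum, hr0]
    ring
  · have h1 : ∀ j, HasDerivAt (fun t => Real.negMulLog (q j t))
        (-(r j * Real.log (q j 0)) - r j) 0 := fun j => by
      by_cases h : q j 0 = 0
      · rw [hrz j h]
        simpa using hasDerivAt_zero_of_isLittleO
          (isLittleO_negMulLog_of_isBigO_sq (hq0 j) (hqO j h))
      · refine ((Real.hasDerivAt_negMulLog h).comp 0 (hq' j)).congr_deriv ?_
        ring
    refine (HasDerivAt.fun_sum fun j _ => h1 j).congr_deriv ?_
    rw [Finset.sum_sub_distrib, hr0, Finset.sum_neg_distrib, sub_zero]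

end EntGen

namespace EntGen

variable {dA dB : ℕ}

/-! ### Vectors supported on the diagonal labels. -/

section DiagVec

theorem diagIdx_fst_injective :
    Function.Injective fun i : Fin (min dA dB) => (diagIdx (dA := dA) (dB := dB) i).1 :=
  Fin.castLE_injective (min_le_left dA dB)

theorem diagIdx_snd_injective :
    Function.Injective fun i : Fin (min dA dB) => (diagIdx (dA := dA) (dB := dB) i).2 :=
  Fin.castLE_injective (min_le_right dA dB)

theorem diagIdx_injective :
    Function.Injective (diagIdx : Fin (min dA dB) → Fin dA × Fin dB) :=
  fun _ _ h => diagIdx_fst_injective (congrArg Prod.fst h)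

theorem diagVec_diagIdx (v : Fin (min dA dB) → ℝ) (i : Fin (min dA dB)) :
    diagVec v (diagIdx i : Fin dA × Fin dB) = v i := by
  simp [diagVec, diagIdx_injective.eq_iff]

theorem exists_eq_diagIdx_of_diagVec_ne_zero {v : Fin (min dA dB) → ℝ} {p : Fin dA × Fin dB}
    (h : diagVec v p ≠ 0) : ∃ i, p = diagIdx i := by
  obtain ⟨i, -, hi⟩ := Finset.exists_ne_zero_of_sum_ne_zero h
  by_contra hne
  push Not at hne
  exact hi (if_neg (hne i))

theorem diagVec_dotProduct (v : Fin (min dA dB) → ℝ) (F : Fin dA × Fin dB → ℝ) :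
    diagVec v ⬝ᵥ F = ∑ i, v i * F (diagIdx i) := by
  simp only [dotProduct, diagVec, Finset.sum_mul, ite_mul, zero_mul]
  rw [Finset.sum_comm]
  simp

theorem sum_diagVec_sq_row (v : Fin (min dA dB) → ℝ) (i : Fin (min dA dB)) :
    ∑ m, diagVec v ((diagIdx i).1, m) ^ 2 = v i ^ 2 := by
  rw [Finset.sum_eq_single (diagIdx i).2]
  · exact congrArg (· ^ 2) (diagVec_diagIdx v i)
  · intro m _ hm
    by_contra h
    obtain ⟨k, hk⟩ := exists_eq_diagIdx_of_diagVec_ne_zero fun h0 => h (by rw [h0]; norm_num)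
    have h1 : (diagIdx i : Fin dA × Fin dB).1 = (diagIdx k).1 := (Prod.ext_iff.mp hk).1
    obtain rfl : i = k := diagIdx_fst_injective h1
    exact hm (congrArg Prod.snd hk)
  · simp

theorem diagVec_mul_diagVec_of_ne (v : Fin (min dA dB) → ℝ) {i j : Fin dA} (hij : i ≠ j)
    (m : Fin dB) : diagVec v (i, m) * diagVec v (j, m) = 0 := by
  by_contra h
  obtain ⟨k, hk⟩ := exists_eq_diagIdx_of_diagVec_ne_zero (left_ne_zero_of_mul h)
  obtain ⟨l, hl⟩ := exists_eq_diagIdx_of_diagVec_ne_zero (right_ne_zero_of_mul h)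
  obtain rfl : k = l := diagIdx_snd_injective <| by
    have h1 : m = (diagIdx k).2 := congrArg Prod.snd hk
    have h2 : m = (diagIdx l).2 := congrArg Prod.snd hl
    exact h1.symm.trans h2
  exact hij ((congrArg Prod.fst hk).trans (congrArg Prod.fst hl).symm)

end DiagVec

/-! ### Coordinates in the Schmidt product basis. -/

section Basis

/-- The matrix whose columns are the vectors of an orthonormal basis. -/
noncomputable def basisMatrix {d : ℕ} (e : OrthonormalBasis (Fin d) ℂ (EuclideanSpace ℂ (Fin d))) :
    Matrix (Fin d) (Fin d) ℂ :=
  Matrix.of fun a j => e j a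

theorem conjTranspose_basisMatrix_mul_self {d : ℕ}
    (e : OrthonormalBasis (Fin d) ℂ (EuclideanSpace ℂ (Fin d))) :
    (basisMatrix e)ᴴ * basisMatrix e = 1 := by
  ext i j
  have h := orthonormal_iff_ite.mp e.orthonormal i j
  rw [Matrix.one_apply, ← h, PiLp.inner_apply, Matrix.mul_apply]
  refine Finset.sum_congr rfl fun a _ => ?_
  simp [basisMatrix, mul_comm]

variable (e : OrthonormalBasis (Fin dA) ℂ (EuclideanSpace ℂ (Fin dA)))
  (f : OrthonormalBasis (Fin dB) ℂ (EuclideanSpace ℂ (Fin dB)))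

/-- The unitary matrix whose columns are the product basis vectors. -/
noncomputable def prodBasisMatrix : Matrix (Fin dA × Fin dB) (Fin dA × Fin dB) ℂ :=
  basisMatrix e ⊗ₖ basisMatrix f

theorem conjTranspose_prodBasisMatrix_mul_self :
    (prodBasisMatrix e f)ᴴ * prodBasisMatrix e f = 1 := by
  rw [prodBasisMatrix, Matrix.conjTranspose_kronecker, ← Matrix.mul_kronecker_mul,
    conjTranspose_basisMatrix_mul_self, conjTranspose_basisMatrix_mul_self,
    Matrix.one_kronecker_one]

theorem prodBasisMatrix_mul_conjTranspose_self :
    prodBasisMatrix e f * (prodBasisMatrix e f)ᴴ = 1 :=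
  mul_eq_one_comm.mp (conjTranspose_prodBasisMatrix_mul_self e f)

theorem prodBasisMatrix_col (p : Fin dA × Fin dB) :
    (prodBasisMatrix e f).col p = prodVec (e p.1) (f p.2) := rfl

theorem imPart_apply (H : Matrix (Fin dA × Fin dB) (Fin dA × Fin dB) ℂ) (p q : Fin dA × Fin dB) :
    imPart e f H p q = (((prodBasisMatrix e f)ᴴ * H * prodBasisMatrix e f) p q).im := by
  rw [imPart, Matrix.of_apply, ← prodBasisMatrix_col e f p, ← prodBasisMatrix_col e f q,
    Matrix.mul_assoc]
  rfl

variable {e f}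

theorem IsSchmidt.eq_mulVec {ψ : Fin dA × Fin dB → ℂ} {C : Fin (min dA dB) → ℝ}
    (h : IsSchmidt ψ e f C) :
    ψ = prodBasisMatrix e f *ᵥ fun p => (diagVec C p : ℂ) := by
  rw [h.sum_eq]
  ext p
  simp only [Finset.sum_apply, Pi.smul_apply, smul_eq_mul, Matrix.mulVec, dotProduct, diagVec,
    Complex.ofReal_sum, apply_ite Complex.ofReal, Complex.ofReal_zero, Finset.mul_sum, mul_ite,
    mul_zero]
  rw [Finset.sum_comm]
  refine Finset.sum_congr rfl fun i _ => ?_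
  rw [Finset.sum_ite_eq' Finset.univ (diagIdx i), if_pos (Finset.mem_univ _), mul_comm]
  rfl

theorem imPart_mulVec (H : Matrix (Fin dA × Fin dB) (Fin dA × Fin dB) ℂ)
    (x : Fin dA × Fin dB → ℝ) (p : Fin dA × Fin dB) :
    (imPart e f H *ᵥ x) p =
      (((prodBasisMatrix e f)ᴴ *ᵥ (H *ᵥ (prodBasisMatrix e f *ᵥ fun p => (x p : ℂ)))) p).im := by
  rw [Matrix.mulVec_mulVec, Matrix.mulVec_mulVec]
  simp only [Matrix.mulVec, dotProduct, imPart_apply, Complex.im_sum, Complex.im_mul_ofReal]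

end Basis

/-! ### Unitary evolution and the rate formula. -/

section Evolution

variable {n : Type*} [Fintype n] [DecidableEq n]

open scoped Matrix.Norms.L2Operator in
theorem hasDerivAt_exp_mulVec_apply (B : Matrix n n ℂ) (H : Matrix n n ℂ) (v : n → ℂ) (p : n) :
    HasDerivAt (fun t : ℝ => (B *ᵥ (NormedSpace.exp ((-(Complex.I * (t : ℂ))) • H) *ᵥ v)) p)
      (-(Complex.I * (B *ᵥ (H *ᵥ v)) p)) 0 := by
  have h1 := hasDerivAt_exp_smul_const (𝕂 := ℝ) ((-Complex.I) • H) (0 : ℝ)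
  let Lin : Matrix n n ℂ →ₗ[ℝ] ℂ :=
    { toFun := fun X => (B *ᵥ (X *ᵥ v)) p
      map_add' := fun X Y => by simp [Matrix.add_mulVec, Matrix.mulVec_add]
      map_smul' := fun r X => by simp [Matrix.smul_mulVec, Matrix.mulVec_smul] }
  have h2 := Lin.toContinuousLinearMap.hasFDerivAt.comp_hasDerivAt (0 : ℝ) h1
  refine (h2.congr_deriv ?_).congr_of_eventuallyEq (Filter.Eventually.of_forall fun t => ?_)
  · simp [Lin, Matrix.smul_mulVec, Matrix.neg_mulVec]
  · have : (-(Complex.I * (t : ℂ))) • H = t • ((-Complex.I) • H) := by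
      ext i j
      simp
      ring
    simp only [this]
    rfl

theorem conjTranspose_exp_I_smul {H : Matrix n n ℂ} (hH : H.IsHermitian) (t : ℝ) :
    (NormedSpace.exp ((-(Complex.I * (t : ℂ))) • H))ᴴ =
      NormedSpace.exp ((Complex.I * (t : ℂ)) • H) := by
  rw [← Matrix.exp_conjTranspose, Matrix.conjTranspose_smul, hH.eq]
  simp

theorem conjTranspose_exp_mul_self {H : Matrix n n ℂ} (hH : H.IsHermitian) (t : ℝ) :
    (NormedSpace.exp ((-(Complex.I * (t : ℂ))) • H))ᴴ *
      NormedSpace.exp ((-(Complex.I * (t : ℂ))) • H) = 1 := by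
  rw [conjTranspose_exp_I_smul hH, ← Matrix.exp_add_of_commute]
  · simp
  · exact ((Commute.refl H).smul_left _).smul_right _

theorem evolvedState_eq (ψ : Fin dA × Fin dB → ℂ)
    {H : Matrix (Fin dA × Fin dB) (Fin dA × Fin dB) ℂ} (hH : H.IsHermitian) (t : ℝ) :
    evolvedState ψ H t =
      Matrix.vecMulVec (NormedSpace.exp ((-(Complex.I * (t : ℂ))) • H) *ᵥ ψ)
        (star (NormedSpace.exp ((-(Complex.I * (t : ℂ))) • H) *ᵥ ψ)) := by
  rw [evolvedState, Matrix.mul_vecMulVec, Matrix.vecMulVec_mul, Matrix.star_mulVec,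
    conjTranspose_exp_I_smul hH]

theorem hasDerivAt_entanglement {ψ : Fin dA × Fin dB → ℂ} (hψ : star ψ ⬝ᵥ ψ = 1)
    {e : OrthonormalBasis (Fin dA) ℂ (EuclideanSpace ℂ (Fin dA))}
    {f : OrthonormalBasis (Fin dB) ℂ (EuclideanSpace ℂ (Fin dB))}
    {C : Fin (min dA dB) → ℝ} (hC : IsSchmidt ψ e f C)
    {H : Matrix (Fin dA × Fin dB) (Fin dA × Fin dB) ℂ} (hH : H.IsHermitian) :
    HasDerivAt (fun t : ℝ => relEntropyEntanglement (evolvedState ψ H t))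
      (-4 * ∑ i, C i * Real.log (C i) * kVec e f C H i) 0 := by
  set B := prodBasisMatrix e f with hB
  have hB1 : Bᴴ * B = 1 := conjTranspose_prodBasisMatrix_mul_self e f
  have hB2 : B * Bᴴ = 1 := prodBasisMatrix_mul_conjTranspose_self e f
  set φ : ℝ → Fin dA × Fin dB → ℂ :=
    fun t => NormedSpace.exp ((-(Complex.I * (t : ℂ))) • H) *ᵥ ψ with hφ
  set c : ℝ → Matrix (Fin dA) (Fin dB) ℂ := fun t => Matrix.of fun i m => (Bᴴ *ᵥ φ t) (i, m)
    with hc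
  have hφc : ∀ t, φ t = (basisMatrix e ⊗ₖ basisMatrix f) *ᵥ vecOf (c t) := fun t => by
    change φ t = B *ᵥ (Bᴴ *ᵥ φ t)
    rw [Matrix.mulVec_mulVec, hB2, Matrix.one_mulVec]
  have he := conjTranspose_basisMatrix_mul_self e
  have hf := conjTranspose_basisMatrix_mul_self f
  have hunit : ∀ t, ∑ j, ∑ m, ‖c t j m‖ ^ 2 = 1 := fun t => by
    have h1 : star (φ t) ⬝ᵥ φ t = 1 := by
      rw [hφ, star_mulVec_dotProduct_mulVec_of_isometry (conjTranspose_exp_mul_self hH t), hψ]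
    rw [hφc, star_vecOf_dotProduct_self he hf] at h1
    exact_mod_cast h1
  have hc0 : ∀ j m, c 0 j m = (diagVec C (j, m) : ℂ) := fun j m => by
    have h1 : φ 0 = ψ := by simp [hφ]
    simp only [hc, h1, Matrix.of_apply]
    rw [hC.eq_mulVec, Matrix.mulVec_mulVec, hB1, Matrix.one_mulVec]
  have hder : ∀ i m, HasDerivAt (fun t => c t i m)
      ((Matrix.of fun i m => -(Complex.I * (Bᴴ *ᵥ (H *ᵥ ψ)) (i, m)) :
        Matrix (Fin dA) (Fin dB) ℂ) i m) 0 :=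
    fun i m => hasDerivAt_exp_mulVec_apply Bᴴ H ψ (i, m)
  have hdiag : ∀ i j, i ≠ j → (c 0 * (c 0)ᴴ) i j = 0 := fun i j hij => by
    rw [Matrix.mul_apply]
    refine Finset.sum_eq_zero fun m _ => ?_
    rw [Matrix.conjTranspose_apply, hc0, hc0, RCLike.star_def, Complex.conj_ofReal,
      ← Complex.ofReal_mul, diagVec_mul_diagVec_of_ne C hij, Complex.ofReal_zero]
  refine (hasDerivAt_entanglement_of_bounds hder hunit hdiag (fun t => ?_)
    (fun t τ hτ => ?_)).congr_deriv ?_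
  · rw [evolvedState_eq ψ hH]
    exact relEntropyEntanglement_pure_le he hf (hunit t) (hφc t)
  · rw [evolvedState_eq ψ hH]
    exact le_relEntropyEntanglement_pure he hf (hunit t) hτ (hφc t)
  · have h1 : ∀ j m, 2 * inner ℝ (c 0 j m) (-(Complex.I * (Bᴴ *ᵥ (H *ᵥ ψ)) (j, m))) =
        diagVec C (j, m) * (2 * ((Bᴴ *ᵥ (H *ᵥ ψ)) (j, m)).im) := fun j m => by
      rw [hc0, Complex.inner, Complex.conj_ofReal, Complex.re_mul_ofReal]
      simp
      ring
    simp only [Matrix.of_apply, h1, Finset.sum_mul, mul_assoc]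
    have h2 := diagVec_dotProduct C (fun p : Fin dA × Fin dB =>
      2 * (((Bᴴ *ᵥ (H *ᵥ ψ)) p).im * Real.log (∑ m, ‖c 0 p.1 m‖ ^ 2)))
    rw [dotProduct, Fintype.sum_prod_type] at h2
    rw [h2, neg_mul, neg_inj, Finset.mul_sum]
    refine Finset.sum_congr rfl fun i _ => ?_
    have h3 : ∑ m, ‖c 0 (diagIdx i).1 m‖ ^ 2 = C i ^ 2 := by
      rw [← sum_diagVec_sq_row]
      refine Finset.sum_congr rfl fun m _ => ?_
      rw [hc0, Complex.norm_real, Real.norm_eq_abs, sq_abs]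
    have h4 : kVec e f C H i = ((Bᴴ *ᵥ (H *ᵥ ψ)) (diagIdx i)).im := by
      rw [kVec, imPart_mulVec, ← hC.eq_mulVec]
    -- The factor `4` is `2` from differentiating a squared modulus times `2` from `log (C i ^ 2)`.
    rw [h3, h4, Real.log_pow]
    push_cast
    ring

end Evolution

end EntGen

/-! ### Variances and the constrained optimisation. -/

namespace EntGen

variable {dA dB : ℕ} {ψ : Fin dA × Fin dB → ℂ}
  {e : OrthonormalBasis (Fin dA) ℂ (EuclideanSpace ℂ (Fin dA))}
  {f : OrthonormalBasis (Fin dB) ℂ (EuclideanSpace ℂ (Fin dB))}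
  {C : Fin (min dA dB) → ℝ} {H : Matrix (Fin dA × Fin dB) (Fin dA × Fin dB) ℂ}

theorem IsSchmidt.dotProduct_diagVec_self (hC : IsSchmidt ψ e f C) (hψ : star ψ ⬝ᵥ ψ = 1) :
    (diagVec C : Fin dA × Fin dB → ℝ) ⬝ᵥ diagVec C = 1 := by
  rw [hC.eq_mulVec, star_mulVec_dotProduct_mulVec_of_isometry
    (conjTranspose_prodBasisMatrix_mul_self e f)] at hψ
  apply Complex.ofReal_injective
  rw [Complex.ofReal_one, ← hψ]
  simp [dotProduct]

theorem transpose_imPart (hH : H.IsHermitian) : (imPart e f H)ᵀ = -imPart e f H := by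
  ext p q
  have h : ((prodBasisMatrix e f)ᴴ * H * prodBasisMatrix e f).IsHermitian :=
    Matrix.isHermitian_conjTranspose_mul_mul _ hH
  rw [Matrix.transpose_apply, Matrix.neg_apply, imPart_apply, imPart_apply, ← h.apply q p,
    RCLike.star_def, Complex.conj_im]

theorem dotProduct_imPart_mulVec_self (hH : H.IsHermitian) (v : Fin dA × Fin dB → ℝ) :
    v ⬝ᵥ (imPart e f H *ᵥ v) = 0 := by
  have h1 : v ⬝ᵥ (imPart e f H *ᵥ v) = -(v ⬝ᵥ (imPart e f H *ᵥ v)) := by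
    rw [← dotProduct_neg, ← Matrix.neg_mulVec, ← transpose_imPart hH, Matrix.mulVec_transpose,
      dotProduct_comm v (v ᵥ* _), ← Matrix.dotProduct_mulVec]
  linarith

theorem imVariance_eq (hH : H.IsHermitian) :
    imVariance e f C H = (imPart e f H *ᵥ diagVec C) ⬝ᵥ (imPart e f H *ᵥ diagVec C) := by
  rw [imVariance, ← Matrix.mulVec_mulVec, Matrix.dotProduct_mulVec, ← Matrix.mulVec_transpose,
    transpose_imPart hH, Matrix.neg_mulVec, neg_dotProduct_neg]

/-- In Schmidt coordinates the state is real, so `Im w = H_I c`, and the mean energy sees only `Re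
w`. -/
theorem variance_eq (hC : IsSchmidt ψ e f C) (hH : H.IsHermitian) {w : Fin dA × Fin dB → ℂ}
    (hw : w = (prodBasisMatrix e f)ᴴ *ᵥ (H *ᵥ ψ)) :
    variance ψ H = (fun p => (w p).re) ⬝ᵥ (fun p => (w p).re) + imVariance e f C H -
      (diagVec C ⬝ᵥ fun p => (w p).re) ^ 2 := by
  have hB := prodBasisMatrix_mul_conjTranspose_self e f
  have h1 : star ψ ⬝ᵥ ((H * H) *ᵥ ψ) = star w ⬝ᵥ w := by
    rw [hw, star_mulVec_dotProduct_mulVec_of_isometry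
      (by rw [Matrix.conjTranspose_conjTranspose, hB]), Matrix.star_mulVec, hH.eq,
      ← Matrix.dotProduct_mulVec, Matrix.mulVec_mulVec]
  have h2 : star ψ ⬝ᵥ (H *ᵥ ψ) = ∑ p, (diagVec C p : ℂ) * w p := by
    have : H *ᵥ ψ = prodBasisMatrix e f *ᵥ w := by
      rw [hw, Matrix.mulVec_mulVec, hB, Matrix.one_mulVec]
    rw [this]
    nth_rewrite 1 [hC.eq_mulVec]
    rw [star_mulVec_dotProduct_mulVec_of_isometry (conjTranspose_prodBasisMatrix_mul_self e f)]
    simp [dotProduct]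
  have h3 : imPart e f H *ᵥ diagVec C = fun p => (w p).im := by
    ext p
    rw [imPart_mulVec, ← hC.eq_mulVec, hw]
  rw [variance, h1, h2, star_dotProduct_self, imVariance_eq hH, h3, Complex.ofReal_re]
  simp only [dotProduct, Complex.re_sum, Complex.re_ofReal_mul, ← Finset.sum_add_distrib,
    Complex.sq_norm, Complex.normSq_apply]

/-- By Cauchy–Schwarz against the unit vector `diagVec C`, the contribution of the real part is
nonnegative. -/
theorem imVariance_le_variance (hC : IsSchmidt ψ e f C) (hψ : star ψ ⬝ᵥ ψ = 1)
    (hH : H.IsHermitian) : imVariance e f C H ≤ variance ψ H := by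
  rw [variance_eq hC hH rfl]
  have h1 := Finset.sum_mul_sq_le_sq_mul_sq Finset.univ (diagVec C : Fin dA × Fin dB → ℝ)
    (fun p => (((prodBasisMatrix e f)ᴴ *ᵥ (H *ᵥ ψ)) p).re)
  have h2 := hC.dotProduct_diagVec_self hψ
  simp only [dotProduct, ← sq] at h2 ⊢
  rw [h2, one_mul] at h1
  linarith

/-- Every real vector orthogonal to the state is the image of the state under the imaginary part
of some Hermitian matrix with vanishing real part. -/
theorem exists_isHermitian_imPart_mulVec_eq (hC : IsSchmidt ψ e f C) (hψ : star ψ ⬝ᵥ ψ = 1)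
    {x : Fin dA × Fin dB → ℝ} (hx : diagVec C ⬝ᵥ x = 0) :
    ∃ H : Matrix (Fin dA × Fin dB) (Fin dA × Fin dB) ℂ, H.IsHermitian ∧
      imPart e f H *ᵥ diagVec C = x ∧ imVariance e f C H = x ⬝ᵥ x ∧ variance ψ H = x ⬝ᵥ x := by
  have hB := conjTranspose_prodBasisMatrix_mul_self e f
  set B := prodBasisMatrix e f with hBdef
  -- With `c` a unit vector and `x ⟂ c`, the antisymmetric `x cᵀ - c xᵀ` sends `c` to `x`. The
  -- Hermitian matrix is `i K` moved to the original basis.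
  set K : Matrix (Fin dA × Fin dB) (Fin dA × Fin dB) ℝ :=
    Matrix.vecMulVec x (diagVec C) - Matrix.vecMulVec (diagVec C) x with hK
  set M : Matrix (Fin dA × Fin dB) (Fin dA × Fin dB) ℂ :=
    Matrix.of fun p q => Complex.I * (K p q : ℂ) with hM
  have hKc : K *ᵥ diagVec C = x := by
    rw [hK, Matrix.sub_mulVec, Matrix.vecMulVec_mulVec, Matrix.vecMulVec_mulVec,
      hC.dotProduct_diagVec_self hψ, dotProduct_comm x, hx]
    simp
  have hKt : ∀ p q, K q p = -K p q := fun p q => by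
    simp [hK, Matrix.vecMulVec_apply, mul_comm]
  have hMh : M.IsHermitian := by
    ext p q
    simp [hM, hKt p q]
  have hH : (B * M * Bᴴ).IsHermitian := Matrix.isHermitian_mul_mul_conjTranspose B hMh
  have hBM : Bᴴ * (B * M * Bᴴ) * B = M := by
    calc _ = (Bᴴ * B) * M * (Bᴴ * B) := by simp only [Matrix.mul_assoc]
      _ = M := by rw [hB, Matrix.one_mul, Matrix.mul_one]
  have himP : imPart e f (B * M * Bᴴ) = K := by
    ext p q
    rw [imPart_apply, ← hBdef, hBM]
    simp [hM]
  have hvec : imPart e f (B * M * Bᴴ) *ᵥ diagVec C = x := by rw [himP, hKc]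
  have hvar : imVariance e f C (B * M * Bᴴ) = x ⬝ᵥ x := by rw [imVariance_eq hH, hvec]
  refine ⟨_, hH, hvec, hvar, ?_⟩
  have hre : (fun p => ((Bᴴ *ᵥ ((B * M * Bᴴ) *ᵥ ψ)) p).re) = 0 := by
    ext p
    rw [hC.eq_mulVec, Matrix.mulVec_mulVec, Matrix.mulVec_mulVec, ← hBdef]
    rw [hBM]
    simp [Matrix.mulVec, dotProduct, hM, mul_assoc]
  rw [variance_eq hC hH rfl, ← hBdef, hre, hvar]
  simp

theorem rate_eq (hψ : star ψ ⬝ᵥ ψ = 1) (hC : IsSchmidt ψ e f C) (hH : H.IsHermitian) :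
    rate ψ H =
      -4 * (diagVec (fun i => C i * Real.log (C i)) ⬝ᵥ (imPart e f H *ᵥ diagVec C)) := by
  rw [rate, (hasDerivAt_entanglement hψ hC hH).deriv, diagVec_dotProduct]
  rfl

/-- The minimiser of a linear functional on the unit ball of a hyperplane. -/
theorem eq_of_forall_dotProduct_le {n : Type*} [Fintype n] {c h x : n → ℝ} (hch : c ⬝ᵥ h = 0)
    (hh : h ≠ 0) (hx : x ⬝ᵥ x ≤ 1)
    (hmin : ∀ y, c ⬝ᵥ y = 0 → y ⬝ᵥ y = 1 → h ⬝ᵥ x ≤ h ⬝ᵥ y) :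
    h = -√(h ⬝ᵥ h) • x ∧ x ⬝ᵥ x = 1 := by
  have hpos : 0 < h ⬝ᵥ h := by
    refine lt_of_le_of_ne (Finset.sum_nonneg fun i _ => mul_self_nonneg _) fun h0 => hh ?_
    exact dotProduct_self_eq_zero.mp h0.symm
  set N := √(h ⬝ᵥ h) with hN
  have hNpos : 0 < N := Real.sqrt_pos.mpr hpos
  have hNN : h ⬝ᵥ h = N * N := (Real.mul_self_sqrt hpos.le).symm
  -- The competitor is the unit vector opposite to `h`, giving `h ⬝ᵥ x ≤ -N`. Then `|h + N x|² ≤ N²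
  -- - 2N² + N² = 0`.
  have h1 := hmin (-N⁻¹ • h) (by rw [dotProduct_smul, hch, smul_zero])
    (by simp only [dotProduct_smul, smul_dotProduct, hNN, smul_eq_mul]; field_simp)
  have h2 : h ⬝ᵥ (-N⁻¹ • h) = -N := by
    simp only [dotProduct_smul, hNN, smul_eq_mul]; field_simp
  rw [h2] at h1
  have h3 : (h + N • x) ⬝ᵥ (h + N • x) = N * N + 2 * N * (h ⬝ᵥ x) + N * N * (x ⬝ᵥ x) := by
    simp only [add_dotProduct, dotProduct_add, dotProduct_smul, smul_dotProduct, smul_eq_mul, hNN,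
      dotProduct_comm x h]
    ring
  have h4 : h + N • x = 0 := by
    refine dotProduct_self_eq_zero.mp (le_antisymm ?_
      (Finset.sum_nonneg fun i _ => mul_self_nonneg _))
    rw [h3]
    nlinarith [mul_le_mul_of_nonneg_left hx (mul_pos hNpos hNpos).le,
      mul_le_mul_of_nonneg_left h1 hNpos.le]
  have h5 : h = -N • x := by rw [neg_smul]; exact eq_neg_of_add_eq_zero_left h4
  refine ⟨h5, ?_⟩
  have h6 := hNN
  rw [h5] at h6
  simp only [dotProduct_smul, smul_dotProduct, smul_eq_mul] at h6
  have h7 : N * N * (x ⬝ᵥ x - 1) = 0 := by linarith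
  rcases mul_eq_zero.mp h7 with h | h
  · exact absurd h (mul_pos hNpos hNpos).ne'
  · linarith

theorem diagVec_sub_smul (v w : Fin (min dA dB) → ℝ) (a : ℝ) :
    (diagVec (fun i => v i - a * w i) : Fin dA × Fin dB → ℝ) = diagVec v - a • diagVec w := by
  ext p
  simp only [diagVec, Pi.sub_apply, Pi.smul_apply, smul_eq_mul, Finset.mul_sum,
    ← Finset.sum_sub_distrib]
  refine Finset.sum_congr rfl fun i _ => ?_
  split_ifs <;> simp

/-- Necessary conditions on a Hermitian matrix that maximises the rate. -/
theorem exists_multipliers (hψ : star ψ ⬝ᵥ ψ = 1) (hC : IsSchmidt ψ e f C) (hH : H.IsHermitian)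
    (hle : imVariance e f C H ≤ 1)
    (hmax : ∀ G : Matrix (Fin dA × Fin dB) (Fin dA × Fin dB) ℂ, G.IsHermitian →
      imVariance e f C G = 1 → variance ψ G = 1 → rate ψ G ≤ rate ψ H) :
    (∃ l₁ l₂ : ℝ, ∀ i, C i * Real.log (C i) - 2 * l₁ * kVec e f C H i - l₂ * C i = 0) ∧
      ((∃ i j, C i ≠ 0 ∧ C j ≠ 0 ∧ C i ≠ C j) →
        imPart e f H *ᵥ diagVec C = diagVec (kVec e f C H) ∧ imVariance e f C H = 1) := by
  set g : Fin (min dA dB) → ℝ := fun i => C i * Real.log (C i) with hg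
  set c : Fin dA × Fin dB → ℝ := diagVec C with hc
  set x := imPart e f H *ᵥ c with hx
  have hcc : c ⬝ᵥ c = 1 := hC.dotProduct_diagVec_self hψ
  have hcx : c ⬝ᵥ x = 0 := dotProduct_imPart_mulVec_self hH c
  set a := c ⬝ᵥ diagVec g with ha
  -- Projection of `g` orthogonal to `C`: it defines the same functional on `c⊥`, and its
  -- coefficient `a` becomes the multiplier of `C i`.
  set h : Fin (min dA dB) → ℝ := fun i => g i - a * C i with hh
  have hdh : (diagVec h : Fin dA × Fin dB → ℝ) = diagVec g - a • c := diagVec_sub_smul g C a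
  have hch : c ⬝ᵥ diagVec h = 0 := by
    rw [hdh, dotProduct_sub, dotProduct_smul, hcc, ← ha]
    simp
  have hhy : ∀ y, c ⬝ᵥ y = 0 → diagVec h ⬝ᵥ y = diagVec g ⬝ᵥ y := fun y hy => by
    rw [hdh, sub_dotProduct, smul_dotProduct, hy]
    simp
  rw [imVariance_eq hH] at hle ⊢
  change x ⬝ᵥ x ≤ 1 at hle
  by_cases h0 : (diagVec h : Fin dA × Fin dB → ℝ) = 0
  · have h1 : ∀ i, g i = a * C i := fun i => by
      have := congrFun h0 (diagIdx i)
      rw [diagVec_diagIdx] at this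
      exact sub_eq_zero.mp this
    refine ⟨⟨0, a, fun i => ?_⟩, ?_⟩
    · have := h1 i
      simp only [hg] at this
      rw [this]
      ring
    · rintro ⟨i, j, hi, hj, hij⟩
      -- When the projection vanishes, all nonzero coefficients share one logarithm, so they cannot
      -- differ.
      have h2 : ∀ i, C i ≠ 0 → Real.log (C i) = a := fun i hi => by
        have := h1 i
        simp only [hg] at this
        rw [mul_comm a] at this
        exact mul_left_cancel₀ hi this
      refine absurd (Real.log_injOn_pos ?_ ?_ ((h2 i hi).trans (h2 j hj).symm)) hij
      · exact (hC.nonneg i).lt_of_ne' hi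
      · exact (hC.nonneg j).lt_of_ne' hj
  · obtain ⟨h1, h2⟩ := eq_of_forall_dotProduct_le hch h0 hle fun y hy hyy => by
      obtain ⟨G, hG, hGv, hGi, hGvar⟩ := exists_isHermitian_imPart_mulVec_eq hC hψ hy
      have h2 := hmax G hG (hGi.trans hyy) (hGvar.trans hyy)
      rw [rate_eq hψ hC hG, rate_eq hψ hC hH, hGv] at h2
      rw [hhy y hy, hhy x hcx]
      linarith
    set N := √(diagVec h ⬝ᵥ (diagVec h : Fin dA × Fin dB → ℝ)) with hN
    refine ⟨⟨-N / 2, a, fun i => ?_⟩, fun _ => ⟨?_, h2⟩⟩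
    · have h3 := congrFun h1 (diagIdx i)
      rw [diagVec_diagIdx] at h3
      change g i - a * C i = -N * kVec e f C H i at h3
      change g i - 2 * (-N / 2) * kVec e f C H i - a * C i = 0
      linarith
    · have hN0 : N ≠ 0 := fun hz => h0 (by rw [h1, hz]; simp)
      ext p
      by_cases hp : ∃ i, p = diagIdx i
      · obtain ⟨i, rfl⟩ := hp
        rw [diagVec_diagIdx]
        rfl
      · have hz : ∀ v : Fin (min dA dB) → ℝ, diagVec v p = 0 := fun v => by
          by_contra hne
          exact hp (exists_eq_diagIdx_of_diagVec_ne_zero hne)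
        have h3 := congrFun h1 p
        rw [hz, Pi.smul_apply, smul_eq_mul] at h3
        rw [hz]
        exact (mul_eq_zero.mp h3.symm).resolve_left (neg_ne_zero.mpr hN0)

end EntGen

/-! ### Assembly of the three claims. -/

theorem theorem1 (dA dB : ℕ) (ψ : Fin dA × Fin dB → ℂ) (hψ : star ψ ⬝ᵥ ψ = 1)
    (e : OrthonormalBasis (Fin dA) ℂ (EuclideanSpace ℂ (Fin dA)))
    (f : OrthonormalBasis (Fin dB) ℂ (EuclideanSpace ℂ (Fin dB)))
    (C : Fin (min dA dB) → ℝ) (hC : EntGen.IsSchmidt ψ e f C) :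
    -- the rate is a genuine derivative
    (∀ H : Matrix (Fin dA × Fin dB) (Fin dA × Fin dB) ℂ, H.IsHermitian →
      DifferentiableAt ℝ
        (fun t : ℝ => EntGen.relEntropyEntanglement (EntGen.evolvedState ψ H t)) 0) ∧
    -- necessary conditions for maximisers
    (∀ H : Matrix (Fin dA × Fin dB) (Fin dA × Fin dB) ℂ,
      (EntGen.IsRateMaximiser ψ (fun G => EntGen.variance ψ G = 1) H ∨
        EntGen.IsRateMaximiser ψ (fun G => EntGen.variance ψ G ≤ 1) H ∨
        EntGen.IsRateMaximiser ψ (fun G => EntGen.imVariance e f C G = 1) H) →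
      (∑ i, C i * EntGen.kVec e f C H i = 0) ∧
      (∃ l₁ l₂ : ℝ, ∀ i,
        C i * Real.log (C i) - 2 * l₁ * EntGen.kVec e f C H i - l₂ * C i = 0) ∧
      (EntGen.imPart e f H *ᵥ EntGen.diagVec C = EntGen.diagVec (EntGen.kVec e f C H) →
        EntGen.imVariance e f C H = 1 → ∑ i, EntGen.kVec e f C H i ^ 2 = 1) ∧
      ((∃ i j, C i ≠ 0 ∧ C j ≠ 0 ∧ C i ≠ C j) →
        EntGen.imPart e f H *ᵥ EntGen.diagVec C = EntGen.diagVec (EntGen.kVec e f C H) ∧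
        EntGen.imVariance e f C H = 1 ∧
        ∑ i, EntGen.kVec e f C H i ^ 2 = 1)) ∧
    -- every admissible vector is realised by an antisymmetric imaginary part
    (∀ k : Fin (min dA dB) → ℝ, ∑ i, C i * k i = 0 → ∑ i, k i ^ 2 = 1 →
      ∃ H : Matrix (Fin dA × Fin dB) (Fin dA × Fin dB) ℂ, H.IsHermitian ∧
        (EntGen.imPart e f H)ᵀ = -EntGen.imPart e f H ∧
        EntGen.imPart e f H *ᵥ EntGen.diagVec C = EntGen.diagVec k ∧
        EntGen.imVariance e f C H = 1 ∧ EntGen.variance ψ H = 1) := by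
  refine ⟨fun H hH => (EntGen.hasDerivAt_entanglement hψ hC hH).differentiableAt, ?_, ?_⟩
  · intro H hmax
    -- The three constraints are treated at once: each implies `imVariance ≤ 1` for `H`, and each
    -- admits all `G` for which both variances equal `1`.
    obtain ⟨hH, hle, hbest⟩ : H.IsHermitian ∧ EntGen.imVariance e f C H ≤ 1 ∧
        ∀ G : Matrix (Fin dA × Fin dB) (Fin dA × Fin dB) ℂ, G.IsHermitian →
          EntGen.imVariance e f C G = 1 → EntGen.variance ψ G = 1 →
            EntGen.rate ψ G ≤ EntGen.rate ψ H := by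
      rcases hmax with ⟨hH, hP, hG⟩ | ⟨hH, hP, hG⟩ | ⟨hH, hP, hG⟩
      · exact ⟨hH, (EntGen.imVariance_le_variance hC hψ hH).trans hP.le,
          fun G hGh _ h2 => hG G hGh h2⟩
      · exact ⟨hH, (EntGen.imVariance_le_variance hC hψ hH).trans hP,
          fun G hGh _ h2 => hG G hGh h2.le⟩
      · exact ⟨hH, hP.le, fun G hGh h1 _ => hG G hGh h1⟩
    obtain ⟨hmul, hne⟩ := EntGen.exists_multipliers hψ hC hH hle hbest
    have hsq : EntGen.imPart e f H *ᵥ EntGen.diagVec C = EntGen.diagVec (EntGen.kVec e f C H) →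
        EntGen.imVariance e f C H = 1 → ∑ i, EntGen.kVec e f C H i ^ 2 = 1 := by
      intro h1 h2
      rw [EntGen.imVariance_eq hH, h1, EntGen.diagVec_dotProduct] at h2
      simpa only [EntGen.diagVec_diagIdx, ← sq] using h2
    refine ⟨?_, hmul, hsq, fun hd => ⟨(hne hd).1, (hne hd).2, hsq (hne hd).1 (hne hd).2⟩⟩
    have h0 := EntGen.dotProduct_imPart_mulVec_self (e := e) (f := f) hH (EntGen.diagVec C)
    rwa [EntGen.diagVec_dotProduct] at h0
  · intro k hk hk1
    have hkk : (EntGen.diagVec k : Fin dA × Fin dB → ℝ) ⬝ᵥ EntGen.diagVec k = 1 := by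
      rw [EntGen.diagVec_dotProduct]
      simpa only [EntGen.diagVec_diagIdx, ← sq] using hk1
    obtain ⟨H, hH, h1, h2, h3⟩ := EntGen.exists_isHermitian_imPart_mulVec_eq hC hψ
      (x := EntGen.diagVec k) (by
        rw [EntGen.diagVec_dotProduct]
        simpa only [EntGen.diagVec_diagIdx] using hk)
    exact ⟨H, hH, EntGen.transpose_imPart hH, h1, h2.trans hkk, h3.trans hkk⟩
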